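/- Let $P=\{p_1,\dots,p_n\}$ be a set of $n$ points in the plane in general position (the points are distinct and no three lie on a line), partitioned into color classes. The \emph{partition spanning forest problem} asks whether there is a forest on the vertex set $P$ such that the vertex sets of its trees are exactly the color classes and such that its straight-line drawing, in which every edge is the segment between its two endpoints, is crossing-free (two distinct edges meet at most in a common endpoint, and no point of $P$ lies in the interior of an edge). \textbf{Theorem.} The partition spanning forest problem for $n$ points in general position can be solved in $O(n^2)$ time if every color class contains at most three points. That is, there is a program for the real RAM (unit-cost operations: arithmetic and comparisons on real numbers; addition, truncated subtraction and comparison of natural numbers; and indirect addressing by natural numbers) which, given $n$, the real coordinates of the points, and a natural number for each point as the label of its color, where every color class has at most three points, halts after $O(n^2)$ steps with the correct answer, yes or no. -/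

import Mathlib

open Filter Asymptotics

/-! ### The partition spanning forest problem -/

namespace PartitionForest

/-- `p` lists `n` points of the plane in general position: the points are distinct and no three of
them lie on a common line. -/
def GeneralPosition {n : ℕ} (p : Fin n → ℝ × ℝ) : Prop :=
  Function.Injective p ∧
    ∀ i j k : Fin n, i ≠ j → j ≠ k → i ≠ k → ¬ Collinear ℝ {p i, p j, p k}

/-- The straight-line drawing of the graph `F` with vertex `i` placed at `p i` is crossing-free:
different vertices are placed at different points, no vertex lies in the relative interior of an
edge, and the relative interiors of any two different edges are disjoint. So two edges can meet
only in a common end vertex. -/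
def CrossingFree {n : ℕ} (p : Fin n → ℝ × ℝ) (F : SimpleGraph (Fin n)) : Prop :=
  Function.Injective p ∧
  (∀ a b v : Fin n, F.Adj a b → p v ∉ openSegment ℝ (p a) (p b)) ∧
  ∀ a b c d : Fin n, F.Adj a b → F.Adj c d → s(a, b) ≠ s(c, d) →
    Disjoint (openSegment ℝ (p a) (p b)) (openSegment ℝ (p c) (p d))

/-- The question of the partition spanning forest problem: is there a forest on the given points
whose trees (connected components) have exactly the color classes as their vertex sets, and whose
straight-line drawing is crossing-free? The color classes are the nonempty fibers of `color`. -/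
def HasPartitionForest {n : ℕ} (p : Fin n → ℝ × ℝ) (color : Fin n → ℕ) : Prop :=
  ∃ F : SimpleGraph (Fin n), F.IsAcyclic ∧
    (∀ i j : Fin n, F.Reachable i j ↔ color i = color j) ∧ CrossingFree p F

end PartitionForest

/-! ### The real RAM

A random access machine with two separate kinds of memory, one for natural numbers and one for real
numbers, programmed in structured form. A program is a finite piece of text, so it names only
finitely many scalar variables and arrays; an array has a cell for each natural number, and cells
are addressed indirectly, through computed natural numbers. Naturals can be added, subtracted
(truncated at zero) and compared; reals can be added, subtracted, multiplied, divided and compared.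
There is no way to pass from reals to naturals except through comparisons, and the only constants
are natural and rational numbers. Every elementary operation takes one step. -/

namespace RealRAM

/-- A memory configuration. -/
@[ext]
structure State where
  /-- scalar variables holding naturals -/
  nvar : ℕ → ℕ
  /-- `narr k i` is cell `i` of the `k`-th array of naturals -/
  narr : ℕ → ℕ → ℕ
  /-- scalar variables holding reals -/
  rvar : ℕ → ℝ
  /-- `rarr k i` is cell `i` of the `k`-th array of reals -/
  rarr : ℕ → ℕ → ℝ

/-- Expressions with values in the naturals. -/
inductive NExp where
  | const (c : ℕ)
  | var (k : ℕ)
  | get (k : ℕ) (i : NExp)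
  | plus (e f : NExp)
  | minus (e f : NExp)

/-- The value of an expression. -/
def NExp.eval (s : State) : NExp → ℕ
  | .const c => c
  | .var k => s.nvar k
  | .get k i => s.narr k (i.eval s)
  | .plus e f => e.eval s + f.eval s
  | .minus e f => e.eval s - f.eval s

/-- The number of steps needed to evaluate an expression. -/
def NExp.cost : NExp → ℕ
  | .const _ => 1
  | .var _ => 1
  | .get _ i => i.cost + 1
  | .plus e f => e.cost + f.cost + 1
  | .minus e f => e.cost + f.cost + 1

/-- Expressions with values in the reals. -/
inductive RExp where
  | const (c : ℚ)
  | var (k : ℕ)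
  | get (k : ℕ) (i : NExp)
  | plus (e f : RExp)
  | minus (e f : RExp)
  | times (e f : RExp)
  | quot (e f : RExp)

/-- The value of an expression. Division by zero yields zero. -/
noncomputable def RExp.eval (s : State) : RExp → ℝ
  | .const c => (c : ℝ)
  | .var k => s.rvar k
  | .get k i => s.rarr k (i.eval s)
  | .plus e f => e.eval s + f.eval s
  | .minus e f => e.eval s - f.eval s
  | .times e f => e.eval s * f.eval s
  | .quot e f => e.eval s / f.eval s

/-- The number of steps needed to evaluate an expression. -/
def RExp.cost : RExp → ℕ
  | .const _ => 1
  | .var _ => 1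
  | .get _ i => i.cost + 1
  | .plus e f => e.cost + f.cost + 1
  | .minus e f => e.cost + f.cost + 1
  | .times e f => e.cost + f.cost + 1
  | .quot e f => e.cost + f.cost + 1

/-- Tests. -/
inductive Test where
  | neq (e f : NExp)
  | nlt (e f : NExp)
  | req (e f : RExp)
  | rlt (e f : RExp)
  | neg (b : Test)
  | conj (b c : Test)
  | disj (b c : Test)

/-- The truth of a test: `neq` and `req` are the equality tests on naturals and on reals, `nlt` and
`rlt` the tests for "less than". -/
def Test.Holds (s : State) : Test → Prop
  | .neq e f => e.eval s = f.eval s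
  | .nlt e f => e.eval s < f.eval s
  | .req e f => e.eval s = f.eval s
  | .rlt e f => e.eval s < f.eval s
  | .neg b => ¬ b.Holds s
  | .conj b c => b.Holds s ∧ c.Holds s
  | .disj b c => b.Holds s ∨ c.Holds s

/-- The number of steps needed to evaluate a test. -/
def Test.cost : Test → ℕ
  | .neq e f => e.cost + f.cost + 1
  | .nlt e f => e.cost + f.cost + 1
  | .req e f => e.cost + f.cost + 1
  | .rlt e f => e.cost + f.cost + 1
  | .neg b => b.cost + 1
  | .conj b c => b.cost + c.cost + 1
  | .disj b c => b.cost + c.cost + 1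

/-- Programs. -/
inductive Prog where
  | skip
  /-- assign the value of `e` to the `k`-th scalar variable for naturals -/
  | nset (k : ℕ) (e : NExp)
  /-- store the value of `e` in cell `i` of the `k`-th array of naturals -/
  | nput (k : ℕ) (i : NExp) (e : NExp)
  /-- assign the value of `e` to the `k`-th scalar variable for reals -/
  | rset (k : ℕ) (e : RExp)
  /-- store the value of `e` in cell `i` of the `k`-th array of reals -/
  | rput (k : ℕ) (i : NExp) (e : RExp)
  | seq (P Q : Prog)
  | cond (b : Test) (P Q : Prog)
  | loop (b : Test) (P : Prog)

/-- `Exec P s s' t`: program `P`, started in memory configuration `s`, halts in configuration `s'`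
after exactly `t` steps. -/
inductive Exec : Prog → State → State → ℕ → Prop where
  | skip (s : State) : Exec .skip s s 1
  | nset (k : ℕ) (e : NExp) (s : State) :
      Exec (.nset k e) s { s with nvar := Function.update s.nvar k (e.eval s) } (e.cost + 1)
  | nput (k : ℕ) (i e : NExp) (s : State) :
      Exec (.nput k i e) s
        { s with narr := Function.update s.narr k
                  (Function.update (s.narr k) (i.eval s) (e.eval s)) }
        (i.cost + e.cost + 1)
  | rset (k : ℕ) (e : RExp) (s : State) :
      Exec (.rset k e) s { s with rvar := Function.update s.rvar k (e.eval s) } (e.cost + 1)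
  | rput (k : ℕ) (i : NExp) (e : RExp) (s : State) :
      Exec (.rput k i e) s
        { s with rarr := Function.update s.rarr k
                  (Function.update (s.rarr k) (i.eval s) (e.eval s)) }
        (i.cost + e.cost + 1)
  | seq {P Q : Prog} {s s' s'' : State} {t t' : ℕ} :
      Exec P s s' t → Exec Q s' s'' t' → Exec (.seq P Q) s s'' (t + t')
  | cond_true {b : Test} {P Q : Prog} {s s' : State} {t : ℕ} :
      b.Holds s → Exec P s s' t → Exec (.cond b P Q) s s' (b.cost + t + 1)
  | cond_false {b : Test} {P Q : Prog} {s s' : State} {t : ℕ} :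
      ¬ b.Holds s → Exec Q s s' t → Exec (.cond b P Q) s s' (b.cost + t + 1)
  | loop_done {b : Test} {P : Prog} {s : State} :
      ¬ b.Holds s → Exec (.loop b P) s s (b.cost + 1)
  | loop_step {b : Test} {P : Prog} {s s' s'' : State} {t t' : ℕ} :
      b.Holds s → Exec P s s' t → Exec (.loop b P) s' s'' t' →
      Exec (.loop b P) s s'' (b.cost + t + t' + 1)

end RealRAM

namespace PartitionForest

/-- The initial memory for an instance of `n` colored points: the number `n` is in scalar variable
`0`, the labels of the colors are in array `0` of the naturals, the two coordinates of the points
are in arrays `0` and `1` of the reals, and everything else is zero. -/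
noncomputable def input {n : ℕ} (p : Fin n → ℝ × ℝ) (color : Fin n → ℕ) : RealRAM.State where
  nvar k := if k = 0 then n else 0
  narr k i := if h : i < n then (if k = 0 then color ⟨i, h⟩ else 0) else 0
  rvar _ := 0
  rarr k i :=
    if h : i < n then
      (if k = 0 then (p ⟨i, h⟩).1 else if k = 1 then (p ⟨i, h⟩).2 else 0)
    else 0

end PartitionForest

/-!
In color classes of at most three points the possible edges of a solution are few: if `nx` permutes
each class cyclically, then every edge of a solution joins some point `i` to `nx i`, so one Boolean
variable for each point suffices. The problem becomes a satisfiability problem with two literals in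
each clause (`hasPartitionForest_iff`): two edges that cross are not both used, and of two edges
of the same class at least one is used. The second kind of clause lets all three sides of a triangle
be used, but then any one of them can be dropped.

There are `O(n ^ 2)` clauses, each of which can be tested for in constant time, so it remains to
solve the satisfiability problem in time `O(n)` per variable. This is done by limited backtracking
in the manner of Even, Itai and Shamir. Given a partial assignment that is closed under unit
propagation, an unassigned variable `u` is chosen, and the consequences of `u` and of its negation
are computed by two propagations in parallel, each processing one literal in a round. As soon as one
of them is complete without conflict, its literals can be added to the assignment for good
(`Trial.closed`); if both meet a conflict, there is no solution (`not_solves_of_conflicts`). A round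
takes time `O(n)`. The winning propagation has fixed one more variable in each of its rounds, so the
work wasted on its competitor is paid for, and `2 * n + 1` rounds are enough (`Race.outcome`).

All loops of the program run through `0, …, n - 1`. Such programs terminate, and their nesting depth
bounds the exponent of the running time (`Cmd.exec_toProg`), so that only the function computed by
the program, `Cmd.run`, has to be analyzed.
-/

/-! ### Programs whose loops are bounded -/

namespace RealRAM

namespace State

/-- Assign the value `v` to the scalar variable `k`. -/
def setVar (s : State) (k v : ℕ) : State := { s with nvar := Function.update s.nvar k v }

/-- Replace the whole content of the `a`-th array of naturals by `f`. -/
def setArr (s : State) (a : ℕ) (f : ℕ → ℕ) : State :=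
  { s with narr := Function.update s.narr a f }

variable (s : State) (k v a j : ℕ) (f : ℕ → ℕ)

@[simp] theorem nvar_setVar : (s.setVar k v).nvar j = if j = k then v else s.nvar j := by
  simp [setVar, Function.update_apply]

@[simp] theorem narr_setVar : (s.setVar k v).narr = s.narr := rfl

@[simp] theorem rarr_setVar : (s.setVar k v).rarr = s.rarr := rfl

@[simp] theorem nvar_setArr : (s.setArr a f).nvar = s.nvar := rfl

@[simp] theorem narr_setArr : (s.setArr a f).narr j = if j = a then f else s.narr j := by
  simp [setArr, Function.update_apply]

@[simp] theorem rarr_setArr : (s.setArr a f).rarr = s.rarr := rfl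

end State

/-- The fragment of the programming language without writes to real memory in which the only loops
are `sweep k P`: run `P` with the scalar variable `k` taking the values `0, 1, …, n - 1`, where `n`
is the content of scalar variable `0`. -/
inductive Cmd where
  | nset (k : ℕ) (e : NExp)
  | nput (k : ℕ) (i e : NExp)
  | seq (P Q : Cmd)
  | cond (b : Test) (P Q : Cmd)
  | skip
  | sweep (k : ℕ) (P : Cmd)

namespace Cmd

/-- The real RAM program of a command. -/
def toProg : Cmd → Prog
  | nset k e => .nset k e
  | nput k i e => .nput k i e
  | seq P Q => .seq P.toProg Q.toProg
  | cond b P Q => .cond b P.toProg Q.toProg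
  | skip => .skip
  | sweep k P => .seq (.nset k (.const 0))
      (.loop (.nlt (.var k) (.var 0))
        (.seq P.toProg (.nset k (.plus (.var k) (.const 1)))))

/-- The command may assign the scalar variable `j`. -/
def Writes (j : ℕ) : Cmd → Prop
  | nset k _ => k = j
  | nput _ _ _ => False
  | seq P Q => P.Writes j ∨ Q.Writes j
  | cond _ P Q => P.Writes j ∨ Q.Writes j
  | skip => False
  | sweep k P => k = j ∨ P.Writes j

/-- No body of a sweep tampers with its counter or with the bound in scalar variable `0`. -/
def WF : Cmd → Prop
  | nset _ _ => True
  | nput _ _ _ => True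
  | seq P Q => P.WF ∧ Q.WF
  | cond _ P Q => P.WF ∧ Q.WF
  | skip => True
  | sweep k P => k ≠ 0 ∧ ¬ P.Writes k ∧ ¬ P.Writes 0 ∧ P.WF

/-- The nesting depth of the sweeps. -/
def depth : Cmd → ℕ
  | nset _ _ => 0
  | nput _ _ _ => 0
  | seq P Q => max P.depth Q.depth
  | cond _ P Q => max P.depth Q.depth
  | skip => 0
  | sweep _ P => P.depth + 1

/-- A factor `K` such that the command takes at most `K * (n + 1) ^ depth` steps. -/
def coeff : Cmd → ℕ
  | nset _ e => e.cost + 1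
  | nput _ i e => i.cost + e.cost + 1
  | seq P Q => P.coeff + Q.coeff
  | cond b P Q => b.cost + P.coeff + Q.coeff + 1
  | skip => 1
  | sweep _ P => P.coeff + 8

open Classical in
/-- The memory after the command has been run. -/
noncomputable def run : Cmd → State → State
  | nset k e, s => s.setVar k (e.eval s)
  | nput a i e, s => s.setArr a (Function.update (s.narr a) (i.eval s) (e.eval s))
  | seq P Q, s => Q.run (P.run s)
  | cond b P Q, s => if b.Holds s then P.run s else Q.run s
  | skip, s => s
  | sweep k P, s =>
      (fun r => (P.run r).setVar k ((P.run r).nvar k + 1))^[s.nvar 0] (s.setVar k 0)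

theorem nvar_run_of_not_writes {j : ℕ} (P : Cmd) (h : ¬ P.Writes j) (s : State) :
    (P.run s).nvar j = s.nvar j := by
  induction P generalizing s with
  | nset k e =>
    have : j ≠ k := fun e => h e.symm
    simp [run, this]
  | nput k i e => simp [run]
  | seq P Q hP hQ =>
    simp only [Writes, not_or] at h
    simp [run, hQ h.2, hP h.1]
  | cond b P Q hP hQ =>
    simp only [Writes, not_or] at h
    simp only [run]
    split_ifs
    · exact hP h.1 s
    · exact hQ h.2 s
  | skip => rfl
  | sweep k P hP =>
    simp only [Writes, not_or] at h
    have hk : j ≠ k := fun e => h.1 e.symm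
    have key : ∀ (m : ℕ) (r : State),
        ((fun r => (P.run r).setVar k ((P.run r).nvar k + 1))^[m] r).nvar j = r.nvar j := by
      intro m
      induction m with
      | zero => intro r; rfl
      | succ m ih => intro r; rw [Function.iterate_succ_apply, ih]; simp [hk, hP h.2]
    simp only [run]
    rw [key]
    simp [hk]

/-- Invariant rule: `I i` holds whenever the counter of the sweep has reached `i`. -/
theorem run_sweep_induction {k : ℕ} {P : Cmd} (hwf : (sweep k P).WF) (I : ℕ → State → Prop)
    (s : State) (h0 : I 0 (s.setVar k 0))
    (hstep : ∀ i < s.nvar 0, ∀ r : State, r.nvar k = i → r.nvar 0 = s.nvar 0 → I i r →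
      I (i + 1) ((P.run r).setVar k (i + 1))) :
    I (s.nvar 0) ((sweep k P).run s) := by
  obtain ⟨hk, hwk, hw0, -⟩ := hwf
  have key : ∀ m ≤ s.nvar 0, ∀ r,
      r = (fun r => (P.run r).setVar k ((P.run r).nvar k + 1))^[m] (s.setVar k 0) →
        r.nvar k = m ∧ r.nvar 0 = s.nvar 0 ∧ I m r := by
    intro m
    induction m with
    | zero => rintro - r rfl; exact ⟨by simp, by simp [hk.symm], h0⟩
    | succ m ih =>
      intro hm r hr
      rw [Function.iterate_succ_apply'] at hr
      obtain ⟨h1, h2, h3⟩ := ih (by omega) _ rfl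
      generalize
        (fun r => (P.run r).setVar k ((P.run r).nvar k + 1))^[m] (s.setVar k 0) = r₀ at *
      have e1 := nvar_run_of_not_writes P hwk r₀
      have e2 := nvar_run_of_not_writes P hw0 r₀
      have := hstep m (by omega) r₀ h1 h2 h3
      subst hr
      refine ⟨by simp [e1, h1], by simp [hk.symm, e2, h2], ?_⟩
      simpa [e1, h1] using this
  exact (key _ le_rfl _ rfl).2.2

/-- The program of a command computes what `run` says, in polynomial time: every sweep multiplies
the running time by `O(n + 1)`. -/
theorem exec_toProg (P : Cmd) (hwf : P.WF) (hw : ¬ P.Writes 0) (s : State) :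
    ∃ t, Exec P.toProg s (P.run s) t ∧ t ≤ P.coeff * (s.nvar 0 + 1) ^ P.depth := by
  induction P generalizing s with
  | nset k e => exact ⟨_, .nset k e s, by simp [coeff, depth]⟩
  | nput k i e => exact ⟨_, .nput k i e s, by simp [coeff, depth]⟩
  | skip => exact ⟨_, .skip s, by simp [coeff, depth]⟩
  | seq P Q hP hQ =>
    simp only [Writes, not_or] at hw
    obtain ⟨t, h1, h2⟩ := hP hwf.1 hw.1 s
    obtain ⟨t', h3, h4⟩ := hQ hwf.2 hw.2 (P.run s)
    rw [nvar_run_of_not_writes P hw.1] at h4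
    refine ⟨_, .seq h1 h3, ?_⟩
    have e1 : (s.nvar 0 + 1) ^ P.depth ≤ (s.nvar 0 + 1) ^ (max P.depth Q.depth) :=
      Nat.pow_le_pow_right (by omega) (le_max_left _ _)
    have e2 : (s.nvar 0 + 1) ^ Q.depth ≤ (s.nvar 0 + 1) ^ (max P.depth Q.depth) :=
      Nat.pow_le_pow_right (by omega) (le_max_right _ _)
    calc t + t' ≤ _ := add_le_add (h2.trans (Nat.mul_le_mul_left _ e1))
          (h4.trans (Nat.mul_le_mul_left _ e2))
      _ = _ := by simp only [coeff, depth]; ring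
  | cond b P Q hP hQ =>
    simp only [Writes, not_or] at hw
    have e0 : 1 ≤ (s.nvar 0 + 1) ^ (max P.depth Q.depth) := Nat.one_le_pow _ _ (by omega)
    have e1 : (s.nvar 0 + 1) ^ P.depth ≤ (s.nvar 0 + 1) ^ (max P.depth Q.depth) :=
      Nat.pow_le_pow_right (by omega) (le_max_left _ _)
    have e2 : (s.nvar 0 + 1) ^ Q.depth ≤ (s.nvar 0 + 1) ^ (max P.depth Q.depth) :=
      Nat.pow_le_pow_right (by omega) (le_max_right _ _)
    by_cases hb : b.Holds s
    · obtain ⟨t, h1, h2⟩ := hP hwf.1 hw.1 s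
      refine ⟨b.cost + t + 1, ?_, ?_⟩
      · simpa only [run, toProg, if_pos hb] using Exec.cond_true hb h1
      · have := h2.trans (Nat.mul_le_mul_left _ e1)
        simp only [coeff, depth]
        nlinarith [Nat.zero_le (Q.coeff * (s.nvar 0 + 1) ^ (max P.depth Q.depth)),
          Nat.mul_le_mul_left (b.cost + 1) e0]
    · obtain ⟨t, h1, h2⟩ := hQ hwf.2 hw.2 s
      refine ⟨b.cost + t + 1, ?_, ?_⟩
      · simpa only [run, toProg, if_neg hb] using Exec.cond_false hb h1
      · have := h2.trans (Nat.mul_le_mul_left _ e2)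
        simp only [coeff, depth]
        nlinarith [Nat.zero_le (P.coeff * (s.nvar 0 + 1) ^ (max P.depth Q.depth)),
          Nat.mul_le_mul_left (b.cost + 1) e0]
  | sweep k P hP =>
    obtain ⟨hk, hwk, hw0, hwfP⟩ := hwf
    have key : ∀ (m : ℕ) (r : State), r.nvar k + m = s.nvar 0 → r.nvar 0 = s.nvar 0 →
        ∃ t, Exec (.loop (.nlt (.var k) (.var 0))
            (.seq P.toProg (.nset k (.plus (.var k) (.const 1))))) r
            ((fun r => (P.run r).setVar k ((P.run r).nvar k + 1))^[m] r) t ∧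
          t ≤ 4 + m * (P.coeff * (s.nvar 0 + 1) ^ P.depth + 8) := by
      intro m
      induction m with
      | zero =>
        intro r h1 h2
        refine ⟨_, .loop_done ?_, by simp [Test.cost, NExp.cost]⟩
        simp only [Test.Holds, NExp.eval]
        omega
      | succ m ih =>
        intro r h1 h2
        obtain ⟨t, e1, e2⟩ := hP hwfP hw0 r
        have a1 := nvar_run_of_not_writes P hwk r
        have a2 := nvar_run_of_not_writes P hw0 r
        obtain ⟨t', e3, e4⟩ := ih ((P.run r).setVar k ((P.run r).nvar k + 1))
          (by simp [a1]; omega) (by simp [hk.symm, a2, h2])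
        rw [Function.iterate_succ_apply]
        refine ⟨_, .loop_step ?_ (.seq e1 (.nset k _ _)) e3, ?_⟩
        · simp only [Test.Holds, NExp.eval]
          omega
        · rw [h2] at e2
          simp only [Test.cost, NExp.cost]
          rw [Nat.succ_mul]
          omega
    obtain ⟨t, e1, e2⟩ := key (s.nvar 0) (s.setVar k 0) (by simp) (by simp [hk.symm])
    refine ⟨_, .seq (.nset k _ s) e1, ?_⟩
    have e0 : 1 ≤ (s.nvar 0 + 1) ^ P.depth := Nat.one_le_pow _ _ (by omega)
    simp only [NExp.cost, coeff, depth, pow_succ]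
    generalize (s.nvar 0 + 1) ^ P.depth = X at *
    nlinarith [Nat.mul_le_mul_left (8 * (s.nvar 0 + 1)) e0, Nat.zero_le (P.coeff * X)]

end Cmd
end RealRAM

/-! ### Crossing segments -/

namespace PartitionForest

/-- Twice the signed area of the triangle `a b c`: it vanishes exactly if the points are collinear,
and its sign tells on which side of the line `a b` the point `c` lies. -/
def orient (a b c : ℝ × ℝ) : ℝ :=
  (b.1 - a.1) * (c.2 - a.2) - (b.2 - a.2) * (c.1 - a.1)

/-- Each of the pairs `a, b` and `c, d` is strictly separated by the line through the other one. -/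
def Crosses (a b c d : ℝ × ℝ) : Prop :=
  orient a b c * orient a b d < 0 ∧ orient c d a * orient c d b < 0

theorem Crosses.symm {a b c d : ℝ × ℝ} (h : Crosses a b c d) : Crosses c d a b :=
  ⟨h.2, h.1⟩

theorem collinear_of_orient_eq_zero {a b c : ℝ × ℝ} (h : orient a b c = 0) :
    Collinear ℝ {a, b, c} := by
  by_cases hab : a = b
  · subst hab
    simpa using collinear_pair ℝ a c
  rw [collinear_iff_of_mem (p₀ := a) (by simp)]
  have hpos : (b.1 - a.1) ^ 2 + (b.2 - a.2) ^ 2 ≠ 0 := by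
    intro h0
    apply hab
    ext <;> nlinarith [sq_nonneg (b.1 - a.1), sq_nonneg (b.2 - a.2)]
  refine ⟨b - a, ?_⟩
  intro q hq
  rcases hq with rfl | rfl | rfl
  · exact ⟨0, by simp⟩
  · exact ⟨1, by simp⟩
  · refine ⟨((q.1 - a.1) * (b.1 - a.1) + (q.2 - a.2) * (b.2 - a.2)) /
      ((b.1 - a.1) ^ 2 + (b.2 - a.2) ^ 2), ?_⟩
    unfold orient at h
    ext
    · simp only [vadd_eq_add, Prod.fst_add, Prod.smul_fst, Prod.fst_sub, smul_eq_mul]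
      field_simp
      linear_combination -(b.2 - a.2) * h
    · simp only [vadd_eq_add, Prod.snd_add, Prod.smul_snd, Prod.snd_sub, smul_eq_mul]
      field_simp
      linear_combination (b.1 - a.1) * h

theorem orient_eq_zero_of_mem_openSegment {a b x : ℝ × ℝ} (h : x ∈ openSegment ℝ a b) :
    orient a b x = 0 := by
  obtain ⟨s, t, -, -, hst, rfl⟩ := h
  obtain rfl : s = 1 - t := by linarith
  simp only [orient, Prod.fst_add, Prod.smul_fst, Prod.snd_add, Prod.smul_snd, smul_eq_mul]
  ring

/-- A function that is affine on a segment and vanishes in its interior has opposite signs at the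
two ends, unless it vanishes at both. -/
theorem orient_mul_orient_neg {a b c d x : ℝ × ℝ} (hx : x ∈ openSegment ℝ a b)
    (hx' : x ∈ openSegment ℝ c d) (h : orient a b c ≠ 0 ∨ orient a b d ≠ 0) :
    orient a b c * orient a b d < 0 := by
  have h0 := orient_eq_zero_of_mem_openSegment hx
  obtain ⟨s, t, hs, ht, hst, rfl⟩ := hx'
  obtain rfl : s = 1 - t := by linarith
  have h1 : (1 - t) * orient a b c + t * orient a b d = 0 := by
    rw [← h0]
    simp only [orient, Prod.fst_add, Prod.smul_fst, Prod.snd_add, Prod.smul_snd, smul_eq_mul]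
    ring
  generalize orient a b c = y at *
  generalize orient a b d = z at *
  rcases h with h | h
  · have hy : 0 < y * y := mul_self_pos.2 h
    have : t * (y * z) = -((1 - t) * (y * y)) := by linear_combination y * h1
    nlinarith [mul_pos hs hy]
  · have hz : 0 < z * z := mul_self_pos.2 h
    have : (1 - t) * (y * z) = -(t * (z * z)) := by linear_combination z * h1
    nlinarith [mul_pos ht hz]

theorem Crosses.not_disjoint {a b c d : ℝ × ℝ} (h : Crosses a b c d) :
    ¬ Disjoint (openSegment ℝ a b) (openSegment ℝ c d) := by
  obtain ⟨h1, h2⟩ := h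
  -- If `y, z` have opposite signs then `y / (y - z)` lies strictly between `0` and `1`.
  have key : ∀ y z : ℝ, y * z < 0 → y - z ≠ 0 ∧ 0 < y / (y - z) ∧ 0 < 1 - y / (y - z) := by
    intro y z hyz
    have hne : y - z ≠ 0 := by
      intro h0
      rw [sub_eq_zero.1 h0] at hyz
      exact absurd hyz (not_lt.2 (mul_self_nonneg z))
    have hsq : 0 < (y - z) * (y - z) := mul_self_pos.2 hne
    refine ⟨hne, ?_, ?_⟩
    · have : y / (y - z) = (y * (y - z)) / ((y - z) * (y - z)) := by field_simp
      rw [this]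
      exact div_pos (by nlinarith [mul_self_nonneg y]) hsq
    · have : 1 - y / (y - z) = (-z * (y - z)) / ((y - z) * (y - z)) := by field_simp; ring
      rw [this]
      exact div_pos (by nlinarith [mul_self_nonneg z]) hsq
  obtain ⟨k1, k2, k3⟩ := key _ _ h1
  obtain ⟨l1, l2, l3⟩ := key _ _ h2
  rw [Set.not_disjoint_iff]
  refine ⟨_, ⟨_, _, l3, l2, by ring, rfl⟩, ⟨_, _, k3, k2, by ring, ?_⟩⟩
  have hD : orient c d a - orient c d b = -(orient a b c - orient a b d) := by
    simp only [orient]; ring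
  rw [hD]
  ext
  · simp only [Prod.fst_add, Prod.smul_fst, smul_eq_mul]
    field_simp
    simp only [orient]
    ring
  · simp only [Prod.snd_add, Prod.smul_snd, smul_eq_mul]
    field_simp
    simp only [orient]
    ring

/-! ### The reduction to clauses with two literals -/

section Forest

variable {n : ℕ} {p : Fin n → ℝ × ℝ} {color : Fin n → ℕ}

theorem GeneralPosition.orient_ne_zero (hp : GeneralPosition p) {i j k : Fin n} (hij : i ≠ j)
    (hjk : j ≠ k) (hik : i ≠ k) : orient (p i) (p j) (p k) ≠ 0 :=
  fun h => hp.2 i j k hij hjk hik (collinear_of_orient_eq_zero h)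

theorem GeneralPosition.crosses (hp : GeneralPosition p) {a b c d : Fin n} (hab : a ≠ b)
    (hcd : c ≠ d) (hne : s(a, b) ≠ s(c, d))
    (h : ¬ Disjoint (openSegment ℝ (p a) (p b)) (openSegment ℝ (p c) (p d))) :
    Crosses (p a) (p b) (p c) (p d) := by
  obtain ⟨x, hx, hx'⟩ := Set.not_disjoint_iff.1 h
  have key : ∀ {a b c d : Fin n}, a ≠ b → c ≠ d → s(a, b) ≠ s(c, d) →
      orient (p a) (p b) (p c) ≠ 0 ∨ orient (p a) (p b) (p d) ≠ 0 := by
    intro a b c d hab hcd hne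
    have h' : (c ≠ a ∧ c ≠ b) ∨ (d ≠ a ∧ d ≠ b) := by
      simp only [ne_eq, Sym2.eq_iff] at hne
      by_contra hcon
      grind
    rcases h' with h' | h'
    · exact .inl (hp.orient_ne_zero hab h'.2.symm h'.1.symm)
    · exact .inr (hp.orient_ne_zero hab h'.2.symm h'.1.symm)
  exact ⟨orient_mul_orient_neg hx hx' (key hab hcd hne),
    orient_mul_orient_neg hx' hx (key hcd hab hne.symm)⟩

theorem GeneralPosition.notMem_openSegment (hp : GeneralPosition p) {a b : Fin n} (hab : a ≠ b)
    (v : Fin n) : p v ∉ openSegment ℝ (p a) (p b) := by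
  intro h
  have hne : p a ≠ p b := fun e => hab (hp.1 e)
  by_cases hva : v = a
  · subst hva
    exact hne (left_mem_openSegment_iff.1 h)
  by_cases hvb : v = b
  · subst hvb
    exact hne (right_mem_openSegment_iff.1 h)
  exact hp.orient_ne_zero hab (Ne.symm hvb) (Ne.symm hva) (orient_eq_zero_of_mem_openSegment h)

/-- `nx` permutes each color class, without fixed points except in singletons. For classes of at
most three points this makes it a cyclic permutation, so the pairs `i, nx i` are all the edges
available to a forest: the three sides of the triangle for a class of three points, and the single
edge, listed twice, for a class of two points. -/
structure IsClassCycle (color : Fin n → ℕ) (nx : Fin n → Fin n) : Prop where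
  color_eq : ∀ i, color (nx i) = color i
  ne_self : ∀ i j, color i = color j → i ≠ j → nx i ≠ i
  injective : Function.Injective nx

theorem eq_of_card_class_le_three
    (hcard : ∀ a : ℕ, (Finset.univ.filter (fun i : Fin n => color i = a)).card ≤ 3)
    {i j k l : Fin n} (hij : i ≠ j) (hik : i ≠ k) (hjk : j ≠ k)
    (cij : color i = color j) (cik : color i = color k) (cil : color i = color l) :
    l = i ∨ l = j ∨ l = k := by
  by_contra hcon
  push Not at hcon
  obtain ⟨h1, h2, h3⟩ := hcon
  have hsub : ({l, i, j, k} : Finset (Fin n)) ⊆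
      Finset.univ.filter (fun m : Fin n => color m = color i) := by
    intro m hm
    simp only [Finset.mem_insert, Finset.mem_singleton] at hm
    simp only [Finset.mem_filter, Finset.mem_univ, true_and]
    grind
  have h4 : ({l, i, j, k} : Finset (Fin n)).card = 4 := by
    rw [Finset.card_insert_of_notMem (by simp [h1, h2, h3]),
      Finset.card_insert_of_notMem (by simp [hij, hik]),
      Finset.card_insert_of_notMem (by simp [hjk]), Finset.card_singleton]
  have := Finset.card_le_card hsub
  have := hcard (color i)
  omega

variable {nx : Fin n → Fin n}

theorem IsClassCycle.cycle (hnx : IsClassCycle color nx)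
    (hcard : ∀ a : ℕ, (Finset.univ.filter (fun i : Fin n => color i = a)).card ≤ 3)
    {i : Fin n} (hi : nx i ≠ i) : nx (nx i) = i ∨ nx (nx (nx i)) = i := by
  by_contra hcon
  push Not at hcon
  have c1 := hnx.color_eq i
  have c2 := hnx.color_eq (nx i)
  have c3 := hnx.color_eq (nx (nx i))
  have h12 : nx (nx i) ≠ nx i := fun h => hi (hnx.injective h)
  have := eq_of_card_class_le_three hcard (i := i) (j := nx i) (k := nx (nx i))
    (l := nx (nx (nx i))) hi.symm hcon.1.symm h12.symm c1.symm (by rw [c2, c1])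
    (by rw [c3, c2, c1])
  rcases this with h | h | h
  · exact hcon.2 h
  · exact hcon.1 (hnx.injective h)
  · exact h12 (hnx.injective h)

theorem IsClassCycle.eq_or_eq (hnx : IsClassCycle color nx)
    (hcard : ∀ a : ℕ, (Finset.univ.filter (fun i : Fin n => color i = a)).card ≤ 3)
    {i j : Fin n} (hij : i ≠ j) (hc : color i = color j) : j = nx i ∨ i = nx j := by
  by_contra hcon
  push Not at hcon
  have c1 := hnx.color_eq i
  have c2 := hnx.color_eq j
  have hi := hnx.ne_self i j hc hij
  have hj := hnx.ne_self j i hc.symm hij.symm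
  have := eq_of_card_class_le_three hcard (i := i) (j := j) (k := nx i) (l := nx j)
    hij hi.symm hcon.1 hc c1.symm (by rw [c2, hc])
  rcases this with h | h | h
  · exact hcon.2 h.symm
  · exact hj h
  · exact hij (hnx.injective h).symm

/-- The problem as a satisfiability problem with two literals in each clause: `σ i` says that the
edge from `i` to `nx i` is used. Two sides of a triangle that are both unused isolate the vertex
they share; conversely, if any two sides of each triangle include a used one, then the used edges
connect each class, and a spanning forest of them is a solution. -/
theorem hasPartitionForest_iff (hp : GeneralPosition p) (hnx : IsClassCycle color nx)
    (hcard : ∀ a : ℕ, (Finset.univ.filter (fun i : Fin n => color i = a)).card ≤ 3) :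
    HasPartitionForest p color ↔ ∃ σ : Fin n → Prop,
      (∀ i j, i ≠ j → color i = color j → σ i ∨ σ j) ∧
      ∀ i j, Crosses (p i) (p (nx i)) (p j) (p (nx j)) → ¬ (σ i ∧ σ j) := by
  constructor
  · rintro ⟨F, -, hreach, -, -, hdisj⟩
    refine ⟨fun i => F.Adj i (nx i), ?_, ?_⟩
    · have nbr : ∀ v w, v ≠ w → color v = color w → ∃ u, F.Adj v u := by
        intro v w hvw hc
        obtain ⟨W⟩ := (hreach v w).2 hc
        cases W with
        | nil => exact absurd rfl hvw
        | cons h _ => exact ⟨_, h⟩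
      -- the sides `i, nx i` and `nx i, nx (nx i)` cannot both be missing
      have key : ∀ i, nx i ≠ i → F.Adj i (nx i) ∨ F.Adj (nx i) (nx (nx i)) := by
        intro i hi
        obtain ⟨u, hu⟩ := nbr (nx i) i hi (hnx.color_eq i)
        have hc := (hreach _ _).1 hu.reachable
        rcases hnx.eq_or_eq hcard hu.ne hc with h | h
        · exact .inr (h ▸ hu)
        · rw [hnx.injective h]
          left
          have := hnx.injective h
          rw [← this] at hu
          rw [← this]
          exact hu.symm
      intro i j hij hc
      rcases hnx.eq_or_eq hcard hij hc with rfl | rfl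
      · exact key i hij.symm
      · exact (key j hij).symm
    · rintro i j hcr ⟨hi, hj⟩
      by_cases he : s(i, nx i) = s(j, nx j)
      · -- an edge does not cross itself: its ends lie on its own line
        obtain ⟨h1, -⟩ := hcr
        rw [Sym2.eq_iff] at he
        rcases he with ⟨h2, -⟩ | ⟨h2, h3⟩
        · subst h2
          simp [orient] at h1
        · rw [← h2] at h1
          simp [orient, mul_comm] at h1
      · exact hcr.not_disjoint (hdisj _ _ _ _ hi hj he)
  · rintro ⟨σ, hmate, hcross⟩
    let G : SimpleGraph (Fin n) := SimpleGraph.fromRel (fun i j => σ i ∧ nx i = j)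
    have hG : ∀ {a b}, G.Adj a b → ∃ i, σ i ∧ (a = i ∧ b = nx i ∨ b = i ∧ a = nx i) := by
      intro a b h
      rcases h with ⟨-, ⟨h1, h2⟩ | ⟨h1, h2⟩⟩
      · exact ⟨a, h1, .inl ⟨rfl, h2.symm⟩⟩
      · exact ⟨b, h1, .inr ⟨rfl, h2.symm⟩⟩
    have hadj : ∀ i, nx i ≠ i → σ i → G.Adj i (nx i) := by
      intro i hi hσ
      exact ⟨hi.symm, .inl ⟨hσ, rfl⟩⟩
    obtain ⟨F, hFG, hF, hreach⟩ := G.exists_isAcyclic_reachable_eq_le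
    have hconn : ∀ i, nx i ≠ i → G.Reachable i (nx i) := by
      intro i hi
      by_cases hσ : σ i
      · exact (hadj i hi hσ).reachable
      have h1 : nx (nx i) ≠ nx i := fun h => hi (hnx.injective h)
      have s1 : σ (nx i) := (hmate _ _ hi (hnx.color_eq i)).resolve_right hσ
      have r1 := (hadj _ h1 s1).reachable
      by_cases h2 : nx (nx i) = i
      · rw [h2] at r1
        exact r1.symm
      have h3 := (hnx.cycle hcard hi).resolve_left h2
      have s2 : σ (nx (nx i)) :=
        (hmate _ _ h2 (by rw [hnx.color_eq, hnx.color_eq])).resolve_right hσ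
      have r2 := (hadj _ (fun h => h1 (hnx.injective h)) s2).reachable
      rw [h3] at r2
      exact (r1.trans r2).symm
    refine ⟨F, hF, fun i j => ?_, hp.1, fun a b v h => hp.notMem_openSegment h.ne v, ?_⟩
    · rw [hreach]
      constructor
      · rintro ⟨W⟩
        induction W with
        | nil => rfl
        | cons h _ ih =>
          rw [← ih]
          obtain ⟨i, -, ⟨rfl, rfl⟩ | ⟨rfl, rfl⟩⟩ := hG h
          · exact (hnx.color_eq _).symm
          · exact hnx.color_eq _
      · intro hc
        by_cases hij : i = j
        · rw [hij]
        rcases hnx.eq_or_eq hcard hij hc with h | h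
        · rw [h]
          exact hconn i (h ▸ Ne.symm hij)
        · rw [h]
          exact (hconn j (h ▸ hij)).symm
    · intro a b c d hab hcd hne
      by_contra hdis
      have hab' := hFG hab
      have hcd' := hFG hcd
      obtain ⟨i, hi, hi'⟩ := hG hab'
      obtain ⟨j, hj, hj'⟩ := hG hcd'
      have e1 : openSegment ℝ (p a) (p b) = openSegment ℝ (p i) (p (nx i)) := by
        rcases hi' with ⟨rfl, rfl⟩ | ⟨rfl, rfl⟩
        · rfl
        · exact openSegment_symm _ _ _
      have e2 : openSegment ℝ (p c) (p d) = openSegment ℝ (p j) (p (nx j)) := by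
        rcases hj' with ⟨rfl, rfl⟩ | ⟨rfl, rfl⟩
        · rfl
        · exact openSegment_symm _ _ _
      have e3 : s(a, b) = s(i, nx i) := by
        rcases hi' with ⟨rfl, rfl⟩ | ⟨rfl, rfl⟩
        · rfl
        · exact Sym2.eq_swap
      have e4 : s(c, d) = s(j, nx j) := by
        rcases hj' with ⟨rfl, rfl⟩ | ⟨rfl, rfl⟩
        · rfl
        · exact Sym2.eq_swap
      have n1 : i ≠ nx i := by
        rcases hi' with ⟨rfl, rfl⟩ | ⟨rfl, rfl⟩
        · exact hab.ne
        · exact hab.ne.symm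
      have n2 : j ≠ nx j := by
        rcases hj' with ⟨rfl, rfl⟩ | ⟨rfl, rfl⟩
        · exact hcd.ne
        · exact hcd.ne.symm
      rw [e1, e2] at hdis
      rw [e3, e4] at hne
      exact hcross i j (hp.crosses n1 n2 hne hdis) ⟨hi, hj⟩

end Forest

end PartitionForest

/-! ### Satisfiability by parallel unit propagation -/

namespace TwoSat

/-- `σ` solves the satisfiability problem in the variables `0, …, n - 1` whose clauses have two
literals. The truth values "true" and "false" are `1` and `2`, and `R v i k` says that there is a
clause forbidding the variables `i` and `k` to have both the value `v`. -/
def Solves (n : ℕ) (R : ℕ → ℕ → ℕ → Prop) (σ : ℕ → ℕ) : Prop :=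
  (∀ i < n, σ i = 1 ∨ σ i = 2) ∧ ∀ i < n, ∀ k < n, R (σ i) i k → σ k ≠ σ i

/-- The partial assignment `A`, with `0` for "unassigned", is closed under unit propagation without
conflict. -/
structure Closed (n : ℕ) (R : ℕ → ℕ → ℕ → Prop) (A : ℕ → ℕ) : Prop where
  le_two : ∀ i < n, A i ≤ 2
  forces : ∀ i < n, ∀ k < n, A i ≠ 0 → R (A i) i k → A k = 3 - A i

/-- The state of the unit propagation from the literal "`u` has the value `b`", on top of the closed
assignment `A`. The literals reached so far are recorded in `V`, those whose consequences have been
drawn are marked in `D`, and `c ≠ 0` signals a conflict. If all variables are assigned, there is no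
literal to start from; then `u` is out of range. -/
structure Trial (n : ℕ) (R : ℕ → ℕ → ℕ → Prop) (A V D : ℕ → ℕ) (c u b : ℕ) : Prop where
  le_two : ∀ i < n, V i ≤ 2
  unassigned : ∀ i < n, V i ≠ 0 → A i = 0
  done : ∀ i < n, D i ≠ 0 → V i ≠ 0
  start : (∃ i < n, A i = 0) → u < n ∧ V u ≠ 0
  forces : c = 0 → ∀ i < n, ∀ k < n, D i ≠ 0 → R (V i) i k → V k = 3 - V i ∨ A k = 3 - V i
  forced : ∀ σ, Solves n R σ → (u < n → σ u = b) → c = 0 ∧ ∀ i < n, V i ≠ 0 → σ i = V i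

variable {n : ℕ} {R : ℕ → ℕ → ℕ → Prop} {A V D : ℕ → ℕ} {c u b : ℕ}

theorem Closed.solves (hA : Closed n R A) (h : ∀ i < n, A i ≠ 0) : Solves n R A := by
  refine ⟨fun i hi => ?_, fun i hi k hk hR => ?_⟩
  · have := hA.le_two i hi
    have := h i hi
    omega
  · have := hA.forces i hi k hk (h i hi) hR
    have := h i hi
    have := hA.le_two i hi
    omega

theorem not_solves_of_conflicts {V₁ D₁ V₂ D₂ : ℕ → ℕ} {c₁ c₂ : ℕ}
    (h₁ : Trial n R A V₁ D₁ c₁ u 1) (h₂ : Trial n R A V₂ D₂ c₂ u 2) (hc₁ : c₁ ≠ 0)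
    (hc₂ : c₂ ≠ 0) (σ : ℕ → ℕ) : ¬ Solves n R σ := by
  intro hσ
  by_cases hu : u < n
  · rcases hσ.1 u hu with h | h
    · exact hc₁ (h₁.forced σ hσ fun _ => h).1
    · exact hc₂ (h₂.forced σ hσ fun _ => h).1
  · exact hc₁ (h₁.forced σ hσ fun h => absurd h hu).1

/-- A conflict-free propagation that has drawn all consequences extends the assignment `A` to a
larger closed one. -/
theorem Trial.closed (hA : Closed n R A) (hT : Trial n R A V D 0 u b)
    (hdone : ∀ i < n, V i ≠ 0 → D i ≠ 0) {A' : ℕ → ℕ}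
    (hA' : ∀ i < n, A' i = if V i ≠ 0 then V i else A i) : Closed n R A' := by
  refine ⟨fun i hi => ?_, fun i hi k hk h0 hR => ?_⟩
  · rw [hA' i hi]
    split_ifs
    · exact hT.le_two i hi
    · exact hA.le_two i hi
  · rw [hA' i hi] at h0 hR ⊢
    rw [hA' k hk]
    have hk0 := hT.unassigned k hk
    by_cases hV : V i ≠ 0
    · simp only [if_pos hV] at hR ⊢
      have h2 := hT.le_two i hi
      rcases hT.forces rfl i hi k hk (hdone i hi hV) hR with h | h
      · rw [if_pos (by omega), h]
      · rw [if_neg (by omega), h]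
    · simp only [if_neg hV] at h0 hR ⊢
      have h1 := hA.forces i hi k hk h0 hR
      have h2 := hA.le_two i hi
      rw [if_neg (by omega), h1]

open Classical in
/-- Drawing the consequences of the literal at `x`. A variable `k` in a clause with that literal
that is already assigned in `A` has the required value there, since otherwise `A`, being closed,
would have assigned `x`. -/
theorem Trial.propagate (hsymm : ∀ v i k, R v i k → R v k i) (hA : Closed n R A)
    (hT : Trial n R A V D 0 u b) {x : ℕ} (hx : x < n) (hVx : V x ≠ 0)
    {V' : ℕ → ℕ} {c' : ℕ}
    (hV' : ∀ k < n, V' k = if R (V x) x k ∧ V k ≠ V x ∧ A k = 0 then 3 - V x else V k)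
    (hc' : c' ≠ 0 ↔ ∃ k < n, R (V x) x k ∧ V k = V x) :
    Trial n R A V' (Function.update D x 1) c' u b := by
  have hx2 := hT.le_two x hx
  have hmono : ∀ k < n, V k ≠ 0 → V' k ≠ 0 := by
    intro k hk h
    rw [hV' k hk]
    split_ifs <;> omega
  have hkeep : ∀ k < n, V k ≠ 0 → V' k = V k := by
    intro k hk h
    rw [hV' k hk]
    split_ifs with h'
    · have := hT.le_two k hk
      omega
    · rfl
  refine ⟨fun i hi => ?_, fun i hi h => ?_, fun i hi h => ?_, fun h => ?_, fun h0 => ?_,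
    fun σ hσ hu => ?_⟩
  · rw [hV' i hi]
    have := hT.le_two i hi
    split_ifs <;> omega
  · rw [hV' i hi] at h
    split_ifs at h with h'
    · exact h'.2.2
    · exact hT.unassigned i hi h
  · by_cases hix : i = x
    · exact hmono i hi (hix ▸ hVx)
    · rw [Function.update_of_ne hix] at h
      exact hmono i hi (hT.done i hi h)
  · obtain ⟨h1, h2⟩ := hT.start h
    exact ⟨h1, hmono u h1 h2⟩
  · intro i hi k hk hD hR
    by_cases hix : i = x
    · subst hix
      rw [hkeep i hi hVx] at hR ⊢
      by_cases hAk : A k = 0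
      · left
        have hne : V k ≠ V i := fun h => hc'.2 ⟨k, hk, hR, h⟩ h0
        rw [hV' k hk, if_pos ⟨hR, hne, hAk⟩]
      · right
        have h2 := hA.le_two k hk
        by_contra hne
        have he : A k = V i := by omega
        have := hA.forces k hk i hi hAk (hsymm _ _ _ (by rw [he]; exact hR))
        have := hT.unassigned i hi hVx
        omega
    · rw [Function.update_of_ne hix] at hD
      have hVi := hT.done i hi hD
      rw [hkeep i hi hVi] at hR ⊢
      have h2 := hT.le_two i hi
      rcases hT.forces rfl i hi k hk hD hR with h | h
      · left
        rw [hkeep k hk (by omega), h]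
      · exact .inr h
  · obtain ⟨-, hag⟩ := hT.forced σ hσ hu
    have hσx := hag x hx hVx
    have hne : ∀ k < n, R (V x) x k → σ k ≠ V x := by
      intro k hk hR
      have := hσ.2 x hx k hk (by rw [hσx]; exact hR)
      rwa [hσx] at this
    constructor
    · by_contra hcc
      obtain ⟨k, hk, hR, he⟩ := hc'.1 hcc
      have h1 := hag k hk (he ▸ hVx)
      exact hne k hk hR (h1.trans he)
    · intro k hk h
      rw [hV' k hk] at h ⊢
      split_ifs at h ⊢ with h'
      · have h1 := hne k hk h'.1
        have h2 := hσ.1 k hk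
        clear hc'
        omega
      · exact hag k hk h

theorem Trial.init (hu : u < n ∧ A u = 0 ∨ u = n ∧ ∀ i < n, A i ≠ 0) (hb : b = 1 ∨ b = 2)
    (hV : ∀ k < n, V k = if k = u then b else 0) (hD : ∀ k < n, D k = 0) :
    Trial n R A V D 0 u b := by
  have hb0 : b ≠ 0 := by omega
  refine ⟨fun i hi => ?_, fun i hi h => ?_, fun i hi h => absurd (hD i hi) h, ?_,
    fun _ i hi k _ h => absurd (hD i hi) h, fun σ _ hσu => ⟨rfl, fun i hi h => ?_⟩⟩
  · rw [hV i hi]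
    split_ifs <;> omega
  · rw [hV i hi] at h
    split_ifs at h with h'
    · subst h'
      rcases hu with hu | hu
      · exact hu.2
      · omega
    · exact absurd rfl h
  · rintro ⟨i, hi, h0⟩
    rcases hu with hu | hu
    · refine ⟨hu.1, ?_⟩
      rw [hV u hu.1, if_pos rfl]
      exact hb0
    · exact absurd h0 (hu.2 i hi)
  · rw [hV i hi] at h ⊢
    split_ifs at h ⊢ with h'
    · subst h'
      exact hσu hi
    · exact absurd rfl h

/-- The number of `i < n` at which `f` does not vanish. -/
def count (n : ℕ) (f : ℕ → ℕ) : ℕ := ((Finset.range n).filter (fun i => f i ≠ 0)).card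

theorem count_update {f : ℕ → ℕ} {x : ℕ} (hx : x < n) (h : f x = 0) :
    count n (Function.update f x 1) = count n f + 1 := by
  unfold count
  rw [← Finset.card_insert_of_notMem (a := x) (by simp [h])]
  congr 1
  ext i
  by_cases hi : i = x
  · subst hi
    simp [hx]
  · simp [hi]

theorem count_eq_zero {f : ℕ → ℕ} (h : ∀ i < n, f i = 0) : count n f = 0 := by
  rw [count, Finset.card_eq_zero, Finset.filter_eq_empty_iff]
  intro i hi
  simp [h i (Finset.mem_range.1 hi)]

theorem count_pos {f : ℕ → ℕ} {x : ℕ} (hx : x < n) (h : f x ≠ 0) : 0 < count n f :=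
  Finset.card_pos.2 ⟨x, by simp [hx, h]⟩

theorem count_add {f g h : ℕ → ℕ} (hd : ∀ i < n, f i ≠ 0 → g i = 0)
    (hh : ∀ i < n, h i ≠ 0 ↔ f i ≠ 0 ∨ g i ≠ 0) : count n h = count n f + count n g := by
  unfold count
  rw [← Finset.card_union_of_disjoint]
  · congr 1
    ext i
    simp only [Finset.mem_filter, Finset.mem_union, Finset.mem_range]
    by_cases hi : i < n
    · simp [hi, hh i hi]
    · simp [hi]
  · rw [Finset.disjoint_filter]
    intro i hi h1 h2
    exact h2 (hd i (Finset.mem_range.1 hi) h1)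

theorem count_le (f : ℕ → ℕ) : count n f ≤ n :=
  (Finset.card_filter_le _ _).trans (by simp)

theorem Trial.count_add_count_le (hT : Trial n R A V D c u b) : count n A + count n D ≤ n := by
  rw [← count_add (f := A) (g := D) (h := fun i => A i + D i)]
  · exact count_le _
  · intro i hi h
    by_contra hD
    exact h (hT.unassigned i hi (hT.done i hi hD))
  · intro i hi
    simp only [ne_eq, Nat.add_eq_zero_iff]
    tauto

/-- The two propagations from `u = 1` and `u = 2`, run in parallel, after `r` rounds:
either the outcome is decided, or `2 * count n A + d ≥ r`, where `d` is the number of literals that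
each propagation without conflict has processed. A round of propagation increases `d`, and when a
complete propagation with `d > 0` literals is added to `A`, the sum rises by `2 * d - d`. -/
structure Race (n : ℕ) (R : ℕ → ℕ → ℕ → Prop) (A : ℕ → ℕ) (V D : ℕ → ℕ → ℕ) (c : ℕ → ℕ) (u r : ℕ) :
    Prop where
  closed : Closed n R A
  trial : ∀ q < 2, Trial n R A (V q) (D q) (c q) u (q + 1)
  progress : (c 0 ≠ 0 ∧ c 1 ≠ 0) ∨ (∀ i < n, A i ≠ 0) ∨
    ∃ d, (∀ q < 2, c q = 0 → count n (D q) = d) ∧ r ≤ 2 * count n A + d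

variable {Vs Ds : ℕ → ℕ → ℕ} {cs : ℕ → ℕ} {r : ℕ}

/-- An undecided race has `count n A + d ≤ n`, as the processed literals belong to different
unassigned variables, so it cannot last longer than `2 * n` rounds. -/
theorem Race.outcome (h : Race n R A Vs Ds cs u r) (hr : 2 * n < r) :
    (cs 0 ≠ 0 ∧ cs 1 ≠ 0) ↔ ¬ ∃ σ, Solves n R σ := by
  constructor
  · rintro ⟨h0, h1⟩ ⟨σ, hσ⟩
    exact not_solves_of_conflicts (h.trial 0 (by omega)) (h.trial 1 (by omega)) h0 h1 σ hσ
  · intro hno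
    rcases h.progress with hp | hp | ⟨d, hd, hle⟩
    · exact hp
    · exact absurd ⟨A, h.closed.solves hp⟩ hno
    · have key : ∀ q < 2, cs q ≠ 0 := by
        intro q hq hc
        have h1 := (h.trial q hq).count_add_count_le
        have h2 := hd q hq hc
        have h3 : count n A ≤ n := count_le A
        omega
      exact ⟨key 0 (by omega), key 1 (by omega)⟩

theorem Race.init (hA : ∀ i < n, A i = 0)
    (hu : u < n ∧ A u = 0 ∨ u = n ∧ ∀ i < n, A i ≠ 0)
    (hV : ∀ q < 2, ∀ k < n, Vs q k = if k = u then q + 1 else 0)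
    (hD : ∀ q < 2, ∀ k < n, Ds q k = 0) (hc : ∀ q < 2, cs q = 0) : Race n R A Vs Ds cs u 0 := by
  refine ⟨⟨fun i hi => ?_, fun i hi _ _ h => absurd (hA i hi) h⟩, fun q hq => ?_, ?_⟩
  · rw [hA i hi]
    omega
  · rw [hc q hq]
    exact Trial.init hu (by omega) (hV q hq) (hD q hq)
  · exact .inr (.inr ⟨0, fun q hq _ => count_eq_zero (hD q hq), by omega⟩)

/-- A round in which a propagation that is complete and free of conflicts is added to `A` and new
propagations are started. -/
theorem Race.commit (h : Race n R A Vs Ds cs u r) {q : ℕ} (hq : q < 2) (hc : cs q = 0)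
    (hdone : ∀ i < n, Vs q i ≠ 0 → Ds q i ≠ 0) {A' : ℕ → ℕ}
    (hA' : ∀ i < n, A' i = if Vs q i ≠ 0 then Vs q i else A i) {u' : ℕ}
    (hu : u' < n ∧ A' u' = 0 ∨ u' = n ∧ ∀ i < n, A' i ≠ 0)
    {V' D' : ℕ → ℕ → ℕ} {c' : ℕ → ℕ}
    (hV : ∀ q < 2, ∀ k < n, V' q k = if k = u' then q + 1 else 0)
    (hD : ∀ q < 2, ∀ k < n, D' q k = 0) (hc' : ∀ q < 2, c' q = 0) :
    Race n R A' V' D' c' u' (r + 1) := by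
  have hT := h.trial q hq
  rw [hc] at hT
  refine ⟨hT.closed h.closed hdone hA', fun q hq => ?_, ?_⟩
  · rw [hc' q hq]
    exact Trial.init hu (by omega) (hV q hq) (hD q hq)
  · rcases h.progress with hp | hp | ⟨d, hd, hle⟩
    · exfalso
      obtain rfl | rfl : q = 0 ∨ q = 1 := by omega
      · exact hp.1 hc
      · exact hp.2 hc
    · right; left
      intro i hi
      rw [hA' i hi]
      split_ifs with h'
      · exact h'
      · exact hp i hi
    · by_cases hall : ∀ i < n, A i ≠ 0
      · right; left
        intro i hi
        rw [hA' i hi]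
        split_ifs with h'
        · exact h'
        · exact hall i hi
      push Not at hall
      right; right
      refine ⟨0, fun q hq _ => count_eq_zero (hD q hq), ?_⟩
      obtain ⟨hu1, hu2⟩ := hT.start hall
      have e1 := hd q hq hc
      have e2 : 0 < count n (Ds q) := count_pos hu1 (hdone u hu1 hu2)
      have e3 : count n A' = count n (Ds q) + count n A := by
        apply count_add
        · intro i hi hDi
          exact hT.unassigned i hi (hT.done i hi hDi)
        · intro i hi
          rw [hA' i hi]
          have a1 := hT.done i hi
          have a2 := hdone i hi
          split_ifs with h'
          · simp [h', a2 h']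
          · simp only [ne_eq, iff_or_self]
            exact fun hDi => absurd (a1 hDi) h'
      omega

open Classical in
/-- A round in which each propagation without conflict processes one literal. -/
theorem Race.propagate (hsymm : ∀ v i k, R v i k → R v k i) (h : Race n R A Vs Ds cs u r)
    {x : ℕ → ℕ} {V' D' : ℕ → ℕ → ℕ} {c' : ℕ → ℕ}
    (hidle : ∀ q < 2, cs q ≠ 0 → V' q = Vs q ∧ D' q = Ds q ∧ c' q = cs q)
    (hx : ∀ q < 2, cs q = 0 → x q < n ∧ Vs q (x q) ≠ 0 ∧ Ds q (x q) = 0)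
    (hV' : ∀ q < 2, cs q = 0 → ∀ k < n, V' q k =
      if R (Vs q (x q)) (x q) k ∧ Vs q k ≠ Vs q (x q) ∧ A k = 0 then 3 - Vs q (x q) else Vs q k)
    (hc' : ∀ q < 2, cs q = 0 →
      (c' q ≠ 0 ↔ ∃ k < n, R (Vs q (x q)) (x q) k ∧ Vs q k = Vs q (x q)))
    (hD' : ∀ q < 2, cs q = 0 → D' q = Function.update (Ds q) (x q) 1) :
    Race n R A V' D' c' u (r + 1) := by
  have hback : ∀ q < 2, c' q = 0 → cs q = 0 := by
    intro q hq h0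
    by_contra hne
    exact hne ((hidle q hq hne).2.2 ▸ h0)
  refine ⟨h.closed, fun q hq => ?_, ?_⟩
  · have hT := h.trial q hq
    by_cases hc : cs q = 0
    · rw [hc] at hT
      rw [hD' q hq hc]
      exact hT.propagate hsymm h.closed (hx q hq hc).1 (hx q hq hc).2.1 (hV' q hq hc)
        (hc' q hq hc)
    · obtain ⟨e1, e2, e3⟩ := hidle q hq hc
      rwa [e1, e2, e3]
  · rcases h.progress with hp | hp | ⟨d, hd, hle⟩
    · left
      rw [(hidle 0 (by omega) hp.1).2.2, (hidle 1 (by omega) hp.2).2.2]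
      exact hp
    · exact .inr (.inl hp)
    · right; right
      refine ⟨d + 1, fun q hq h0 => ?_, by omega⟩
      have hc := hback q hq h0
      rw [hD' q hq hc, count_update (hx q hq hc).1 (hx q hq hc).2.2, hd q hq hc]

end TwoSat

namespace PartitionForest

open RealRAM RealRAM.Cmd TwoSat

/-! ### The program -/

/-- The expression for `orient` at the points with the indices `a, b, c`. -/
def orientExp (a b c : NExp) : RExp :=
  .minus (.times (.minus (.get 0 b) (.get 0 a)) (.minus (.get 1 c) (.get 1 a)))
    (.times (.minus (.get 1 b) (.get 1 a)) (.minus (.get 0 c) (.get 0 a)))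

/-- The test for `Crosses` at the points with the indices `a, b, c, d`. -/
def crossTest (a b c d : NExp) : Test :=
  .conj (.rlt (.times (orientExp a b c) (orientExp a b d)) (.const 0))
    (.rlt (.times (orientExp c d a) (orientExp c d b)) (.const 0))

/-- The test for `Rel`. -/
def relTest (v i k : NExp) : Test :=
  .disj (.conj (.neq v (.const 1)) (crossTest i (.get 1 i) k (.get 1 k)))
    (.conj (.neq v (.const 2)) (.conj (.neg (.neq i k)) (.neq (.get 0 i) (.get 0 k))))

/-- Compute array `1`: the cyclic successor of each point in its color class, in the order of the
indices. The candidate is the point itself at first; it gives way to the first other point of the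
class, and a candidate before the point gives way to one after it. -/
def succCmd : Cmd :=
  .sweep 1 (.seq (.nput 1 (.var 1) (.var 1))
    (.sweep 2 (.cond
      (.conj (.neq (.get 0 (.var 2)) (.get 0 (.var 1)))
        (.conj (.neg (.neq (.var 2) (.var 1)))
          (.disj (.neq (.get 1 (.var 1)) (.var 1))
            (.conj (.nlt (.get 1 (.var 1)) (.var 1)) (.nlt (.var 1) (.var 2))))))
      (.nput 1 (.var 1) (.var 2)) .skip)))

/-- Put into variable `3 + q` some literal of propagation `q` that has not been processed, or `n` if
there is none. Propagation `q` has its literals in array `3 + q`, the marks of the processed ones in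
array `5 + q`, and its conflict flag in variable `5 + q`. -/
def findCmd (q : ℕ) : Cmd :=
  .seq (.nset (3 + q) (.var 0))
    (.sweep 2 (.cond (.conj (.neg (.neq (.get (3 + q) (.var 2)) (.const 0)))
        (.neq (.get (5 + q) (.var 2)) (.const 0)))
      (.nset (3 + q) (.var 2)) .skip))

/-- Draw the consequence that the literal found by `findCmd` has for the variable with the number in
variable `2`. The permanent assignment is in array `2`. -/
def consequenceCmd (q : ℕ) : Cmd :=
  .cond (relTest (.get (3 + q) (.var (3 + q))) (.var (3 + q)) (.var 2))
    (.cond (.neq (.get (3 + q) (.var 2)) (.get (3 + q) (.var (3 + q))))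
      (.nset (5 + q) (.const 1))
      (.cond (.neq (.get 2 (.var 2)) (.const 0))
        (.nput (3 + q) (.var 2) (.minus (.const 3) (.get (3 + q) (.var (3 + q)))))
        .skip))
    .skip

/-- Draw all consequences of the literal that `findCmd` has found, and mark it as processed. -/
def propagateCmd (q : ℕ) : Cmd :=
  .seq (.sweep 2 (consequenceCmd q)) (.nput (5 + q) (.var (3 + q)) (.const 1))

/-- One step of propagation `q`, if it has met no conflict. -/
def stepCmd (q : ℕ) : Cmd :=
  .cond (.neq (.var (5 + q)) (.const 0)) (propagateCmd q) .skip

/-- Add the literals of propagation `q` to the permanent assignment. -/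
def commitCmd (q : ℕ) : Cmd :=
  .sweep 2 (.cond (.neq (.get (3 + q) (.var 2)) (.const 0)) .skip
    (.nput 2 (.var 2) (.get (3 + q) (.var 2))))

/-- Put into variable `7` some unassigned variable, or `n` if there is none. -/
def chooseCmd : Cmd :=
  .seq (.nset 7 (.var 0))
    (.sweep 2 (.cond (.neq (.get 2 (.var 2)) (.const 0)) (.nset 7 (.var 2)) .skip))

/-- Reset propagation `q` to the single literal giving the value `q + 1` to the variable found by
`chooseCmd`. -/
def resetCmd (q : ℕ) : Cmd :=
  .seq (.nset (5 + q) (.const 0))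
    (.sweep 2 (.seq (.nput (5 + q) (.var 2) (.const 0))
      (.cond (.neq (.var 2) (.var 7)) (.nput (3 + q) (.var 2) (.const (q + 1)))
        (.nput (3 + q) (.var 2) (.const 0)))))

/-- Start new propagations. -/
def restartCmd : Cmd := .seq chooseCmd (.seq (resetCmd 0) (resetCmd 1))

/-- Propagation `q` has met no conflict and has no literal left to process. -/
def doneTest (q : ℕ) : Test :=
  .conj (.neq (.var (5 + q)) (.const 0)) (.neq (.var (3 + q)) (.var 0))

/-- One round of the race between the two propagations. -/
def roundCmd : Cmd :=
  .seq (findCmd 0) (.seq (findCmd 1)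
    (.cond (doneTest 0) (.seq (commitCmd 0) restartCmd)
      (.cond (doneTest 1) (.seq (commitCmd 1) restartCmd)
        (.seq (stepCmd 0) (stepCmd 1)))))

/-- The decision procedure: after `2 * n + 1` rounds the instance is a no-instance exactly if both
conflict flags are raised. -/
def mainCmd : Cmd :=
  .seq succCmd (.seq restartCmd (.seq (.sweep 1 roundCmd) (.seq (.sweep 1 roundCmd) roundCmd)))

/-! ### Correctness of the parts of the program -/

/-- The clauses: two crossing edges are not both used, and two edges of the same class are not both
unused. Here `X 0` and `X 1` are the coordinates, and the edge `i` goes from `i` to `nx i`. -/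
def Rel (X : ℕ → ℕ → ℝ) (col nx : ℕ → ℕ) (v i k : ℕ) : Prop :=
  (v = 1 ∧ Crosses (X 0 i, X 1 i) (X 0 (nx i), X 1 (nx i)) (X 0 k, X 1 k)
    (X 0 (nx k), X 1 (nx k))) ∨ (v = 2 ∧ i ≠ k ∧ col i = col k)

theorem Rel.symm {X : ℕ → ℕ → ℝ} {col nx : ℕ → ℕ} (v i k : ℕ) (h : Rel X col nx v i k) :
    Rel X col nx v k i :=
  h.imp (fun h => ⟨h.1, h.2.symm⟩) (fun h => ⟨h.1, h.2.1.symm, h.2.2.symm⟩)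

theorem relTest_holds (s : State) (v i k : NExp) :
    (relTest v i k).Holds s ↔
      Rel s.rarr (s.narr 0) (s.narr 1) (v.eval s) (i.eval s) (k.eval s) := by
  simp [relTest, crossTest, orientExp, Test.Holds, RExp.eval, NExp.eval, Rel, Crosses, orient]

variable (s : State) (q : ℕ)

theorem findCmd_spec (hq : q < 2) :
    let s' := (findCmd q).run s
    s'.rarr = s.rarr ∧ s'.narr = s.narr ∧ (∀ j, j ≠ 2 → j ≠ 3 + q → s'.nvar j = s.nvar j) ∧
    ((s'.nvar (3 + q) = s.nvar 0 ∧ ∀ k < s.nvar 0, s.narr (3 + q) k ≠ 0 → s.narr (5 + q) k ≠ 0) ∨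
      (s'.nvar (3 + q) < s.nvar 0 ∧ s.narr (3 + q) (s'.nvar (3 + q)) ≠ 0 ∧
        s.narr (5 + q) (s'.nvar (3 + q)) = 0)) := by
  have h30 : 0 ≠ 3 + q := by omega
  have h32 : 3 + q ≠ 2 := by omega
  let s₁ := s.setVar (3 + q) (s.nvar 0)
  have h := run_sweep_induction (k := 2)
    (P := .cond (.conj (.neg (.neq (.get (3 + q) (.var 2)) (.const 0)))
        (.neq (.get (5 + q) (.var 2)) (.const 0))) (.nset (3 + q) (.var 2)) .skip)
    (by simp [WF, Writes]; omega)
    (fun i r => r.rarr = s.rarr ∧ r.narr = s.narr ∧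
      (∀ j, j ≠ 2 → j ≠ 3 + q → r.nvar j = s.nvar j) ∧
      ((r.nvar (3 + q) = s.nvar 0 ∧ ∀ k < i, s.narr (3 + q) k ≠ 0 → s.narr (5 + q) k ≠ 0) ∨
      (r.nvar (3 + q) < s.nvar 0 ∧ s.narr (3 + q) (r.nvar (3 + q)) ≠ 0 ∧
        s.narr (5 + q) (r.nvar (3 + q)) = 0))) s₁
    ?_ ?_
  · rw [show s₁.nvar 0 = s.nvar 0 by simp [s₁, h30]] at h
    exact h
  · simp +contextual [s₁, h32]
  · rintro i hi r hr hr0 ⟨h1, h2, h3, h4⟩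
    simp only [s₁, State.nvar_setVar, if_neg h30] at hi
    simp only [run, Test.Holds, NExp.eval, hr, h2]
    split_ifs with hc
    · refine ⟨h1, h2, fun j hj hj' => by simp [hj, hj', h3], .inr ?_⟩
      simpa [h32] using ⟨hi, hc⟩
    · refine ⟨h1, h2, fun j hj hj' => by simp [hj, h3 j hj hj'], ?_⟩
      simp only [State.nvar_setVar, if_neg h32]
      rcases h4 with ⟨h4, h5⟩ | h4
      · refine .inl ⟨h4, fun k hk => ?_⟩
        rcases Nat.lt_succ_iff_lt_or_eq.1 hk with hk | rfl
        · exact h5 k hk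
        · tauto
      · exact .inr h4

open Classical in
theorem propagateCmd_spec (hq : q < 2) (hc0 : s.nvar (5 + q) = 0) :
    let s' := (propagateCmd q).run s
    let x := s.nvar (3 + q)
    let V := s.narr (3 + q)
    let R := Rel s.rarr (s.narr 0) (s.narr 1)
    s'.rarr = s.rarr ∧ (∀ a, a ≠ 3 + q → a ≠ 5 + q → s'.narr a = s.narr a) ∧
    (∀ j, j ≠ 2 → j ≠ 5 + q → s'.nvar j = s.nvar j) ∧
    s'.narr (5 + q) = Function.update (s.narr (5 + q)) x 1 ∧
    (∀ k < s.nvar 0, s'.narr (3 + q) k =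
      if R (V x) x k ∧ V k ≠ V x ∧ s.narr 2 k = 0 then 3 - V x else V k) ∧
    (s'.nvar (5 + q) ≠ 0 ↔ ∃ k < s.nvar 0, R (V x) x k ∧ V k = V x) := by
  intro s' x V R
  have h := run_sweep_induction (k := 2) (P := consequenceCmd q) (by simp [consequenceCmd, WF, Writes]; omega)
    (fun i r => r.rarr = s.rarr ∧ (∀ a, a ≠ 3 + q → r.narr a = s.narr a) ∧
      (∀ j, j ≠ 2 → j ≠ 5 + q → r.nvar j = s.nvar j) ∧
      (∀ k, r.narr (3 + q) k =
        if k < i ∧ R (V x) x k ∧ V k ≠ V x ∧ s.narr 2 k = 0 then 3 - V x else V k) ∧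
      (r.nvar (5 + q) ≠ 0 ↔ ∃ k < i, R (V x) x k ∧ V k = V x)) s
    ?_ ?_
  · have hs' : s' = (nput (5 + q) (.var (3 + q)) (.const 1)).run
        ((sweep 2 (consequenceCmd q)).run s) := rfl
    rw [hs']
    obtain ⟨h1, h2, h3, h4, h5⟩ := h
    generalize (sweep 2 _).run s = s₁ at *
    have e35 : 3 + q ≠ 5 + q := by omega
    have e3 := h3 (3 + q) (by omega) (by omega)
    have e5 := h2 (5 + q) (by omega)
    simp only [run, State.rarr_setArr, State.nvar_setArr, State.narr_setArr,
      if_neg e35, NExp.eval, e3, e5, if_true]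
    refine ⟨h1, fun a ha ha' => ?_, h3, rfl, fun k hk => ?_, h5⟩
    · rw [if_neg ha', h2 a ha]
    · rw [h4 k]
      simp [hk]
  · have e : 5 + q ≠ 2 := by omega
    refine ⟨rfl, fun _ _ => rfl, fun j hj _ => by simp [hj], fun k => by simp [V], ?_⟩
    simp [e, hc0]
  · rintro i hi r hr hr0 ⟨h1, h2, h3, h4, h5⟩
    have e3 : r.nvar (3 + q) = x := h3 (3 + q) (by omega) (by omega)
    have eV : r.narr (3 + q) x = V x := by
      rw [h4]
      simp
    have eVi : r.narr (3 + q) i = V i := by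
      rw [h4]
      simp
    have eA : r.narr 2 = s.narr 2 := h2 2 (by omega)
    have e52 : 5 + q ≠ 2 := by omega
    have eR : Rel r.rarr (r.narr 0) (r.narr 1) = R := by
      rw [h1, h2 0 (by omega), h2 1 (by omega)]
    -- the effect of step `i` on the two parts of the invariant, when cell `i` keeps its content
    have keepV : (¬ (R (V x) x i ∧ V i ≠ V x ∧ s.narr 2 i = 0)) → ∀ k, r.narr (3 + q) k =
        if k < i + 1 ∧ R (V x) x k ∧ V k ≠ V x ∧ s.narr 2 k = 0 then 3 - V x else V k := by
      intro hn k
      rw [h4 k]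
      by_cases hk : k = i
      · subst hk
        rw [if_neg (fun h => hn h.2), if_neg (fun h => hn h.2)]
      · have : k < i + 1 ↔ k < i := by omega
        simp only [this]
    have keepc : (¬ (R (V x) x i ∧ V i = V x)) →
        (r.nvar (5 + q) ≠ 0 ↔ ∃ k < i + 1, R (V x) x k ∧ V k = V x) := by
      intro hn
      rw [h5]
      constructor
      · rintro ⟨k, hk, h⟩
        exact ⟨k, by omega, h⟩
      · rintro ⟨k, hk, h⟩
        refine ⟨k, ?_, h⟩
        rcases Nat.lt_succ_iff_lt_or_eq.1 hk with hk | rfl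
        · exact hk
        · exact absurd h hn
    simp only [consequenceCmd, run, relTest_holds, Test.Holds, NExp.eval, hr, e3, eV, eVi, eA, eR]
    split_ifs with hc1 hc2 hc3
    · refine ⟨h1, h2, fun j hj hj' => by simp [hj, hj', h3], keepV (fun h => h.2.1 hc2), ?_⟩
      simp only [State.nvar_setVar, if_neg e52]
      simp only [if_true, ne_eq, one_ne_zero, not_false_eq_true, true_iff]
      exact ⟨i, by omega, hc1, hc2⟩
    · refine ⟨h1, fun a ha => by simp [ha, h2], fun j hj hj' => by simp [hj, h3 j hj hj'],
        fun k => ?_, ?_⟩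
      · simp only [State.narr_setVar, State.narr_setArr, if_true]
        by_cases hk : k = i
        · subst hk
          rw [Function.update_self, if_pos ⟨by omega, hc1, hc2, hc3⟩]
        · rw [Function.update_of_ne hk, h4 k]
          have : k < i + 1 ↔ k < i := by omega
          simp only [this]
      · simp only [State.nvar_setVar, if_neg e52, State.nvar_setArr]
        exact keepc (fun h => hc2 h.2)
    · refine ⟨h1, h2, fun j hj hj' => by simp [hj, h3 j hj hj'], keepV (fun h => hc3 h.2.2), ?_⟩
      simp only [State.nvar_setVar, if_neg e52]
      exact keepc (fun h => hc2 h.2)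
    · refine ⟨h1, h2, fun j hj hj' => by simp [hj, h3 j hj hj'], keepV (fun h => hc1 h.1), ?_⟩
      simp only [State.nvar_setVar, if_neg e52]
      exact keepc (fun h => hc1 h.1)

theorem commitCmd_spec (hq : q < 2) :
    let s' := (commitCmd q).run s
    s'.rarr = s.rarr ∧ (∀ a, a ≠ 2 → s'.narr a = s.narr a) ∧
    (∀ j, j ≠ 2 → s'.nvar j = s.nvar j) ∧
    (∀ k < s.nvar 0, s'.narr 2 k =
      if s.narr (3 + q) k ≠ 0 then s.narr (3 + q) k else s.narr 2 k) := by
  intro s'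
  have h := run_sweep_induction (k := 2)
    (P := .cond (.neq (.get (3 + q) (.var 2)) (.const 0)) .skip
      (.nput 2 (.var 2) (.get (3 + q) (.var 2))))
    (by simp [WF, Writes])
    (fun i r => r.rarr = s.rarr ∧ (∀ a, a ≠ 2 → r.narr a = s.narr a) ∧
      (∀ j, j ≠ 2 → r.nvar j = s.nvar j) ∧
      (∀ k, r.narr 2 k =
        if k < i ∧ s.narr (3 + q) k ≠ 0 then s.narr (3 + q) k else s.narr 2 k)) s
    ?_ ?_
  · obtain ⟨h1, h2, h3, h4⟩ := h
    refine ⟨h1, h2, h3, fun k hk => ?_⟩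
    rw [show s'.narr 2 k = _ from h4 k]
    simp [hk]
  · exact ⟨rfl, fun _ _ => rfl, fun j hj => by simp [hj], fun k => by simp⟩
  · rintro i hi r hr hr0 ⟨h1, h2, h3, h4⟩
    have e3 := h2 (3 + q) (by omega)
    simp only [run, Test.Holds, NExp.eval, hr, e3]
    split_ifs with hc
    · refine ⟨h1, h2, fun j hj => by simp [hj, h3 j hj], fun k => ?_⟩
      rw [State.narr_setVar, h4]
      by_cases hk : k = i
      · subst hk
        simp [hc]
      · have : k < i + 1 ↔ k < i := by omega
        simp only [this]
    · refine ⟨h1, fun a ha => by simp [ha, h2], fun j hj => by simp [hj, h3 j hj], fun k => ?_⟩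
      simp only [State.narr_setVar, State.narr_setArr, if_true]
      by_cases hk : k = i
      · subst hk
        simp [hc]
      · rw [Function.update_of_ne hk, h4 k]
        have : k < i + 1 ↔ k < i := by omega
        simp only [this]

theorem chooseCmd_spec :
    let s' := chooseCmd.run s
    s'.rarr = s.rarr ∧ s'.narr = s.narr ∧ (∀ j, j ≠ 2 → j ≠ 7 → s'.nvar j = s.nvar j) ∧
    ((s'.nvar 7 < s.nvar 0 ∧ s.narr 2 (s'.nvar 7) = 0) ∨
      (s'.nvar 7 = s.nvar 0 ∧ ∀ k < s.nvar 0, s.narr 2 k ≠ 0)) := by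
  have h := run_sweep_induction (k := 2)
    (P := .cond (.neq (.get 2 (.var 2)) (.const 0)) (.nset 7 (.var 2)) .skip)
    (by simp [WF, Writes])
    (fun i r => r.rarr = s.rarr ∧ r.narr = s.narr ∧
      (∀ j, j ≠ 2 → j ≠ 7 → r.nvar j = s.nvar j) ∧
      ((r.nvar 7 < s.nvar 0 ∧ s.narr 2 (r.nvar 7) = 0) ∨
        (r.nvar 7 = s.nvar 0 ∧ ∀ k < i, s.narr 2 k ≠ 0))) (s.setVar 7 (s.nvar 0))
    ?_ ?_
  · rw [show (s.setVar 7 (s.nvar 0)).nvar 0 = s.nvar 0 by simp] at h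
    exact h
  · simp +contextual
  · rintro i hi r hr hr0 ⟨h1, h2, h3, h4⟩
    simp only [State.nvar_setVar] at hi
    simp only [run, Test.Holds, NExp.eval, hr, h2]
    split_ifs with hc
    · refine ⟨h1, h2, fun j hj hj' => by simp [hj, hj', h3], .inl ?_⟩
      simpa using ⟨hi, hc⟩
    · refine ⟨h1, h2, fun j hj hj' => by simp [hj, h3 j hj hj'], ?_⟩
      simp only [State.nvar_setVar]
      rcases h4 with h4 | ⟨h4, h5⟩
      · exact .inl h4
      · refine .inr ⟨h4, fun k hk => ?_⟩
        rcases Nat.lt_succ_iff_lt_or_eq.1 hk with hk | rfl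
        · exact h5 k hk
        · exact hc

theorem resetCmd_spec (hq : q < 2) :
    let s' := (resetCmd q).run s
    s'.rarr = s.rarr ∧ (∀ a, a ≠ 3 + q → a ≠ 5 + q → s'.narr a = s.narr a) ∧
    (∀ j, j ≠ 2 → j ≠ 5 + q → s'.nvar j = s.nvar j) ∧ s'.nvar (5 + q) = 0 ∧
    (∀ k < s.nvar 0, s'.narr (5 + q) k = 0) ∧
    (∀ k < s.nvar 0, s'.narr (3 + q) k = if k = s.nvar 7 then q + 1 else 0) := by
  have e50 : 0 ≠ 5 + q := by omega
  have e52 : 5 + q ≠ 2 := by omega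
  have e53 : 5 + q ≠ 3 + q := by omega
  have h := run_sweep_induction (k := 2)
    (P := .seq (.nput (5 + q) (.var 2) (.const 0))
      (.cond (.neq (.var 2) (.var 7)) (.nput (3 + q) (.var 2) (.const (q + 1)))
        (.nput (3 + q) (.var 2) (.const 0))))
    (by simp [WF, Writes])
    (fun i r => r.rarr = s.rarr ∧ (∀ a, a ≠ 3 + q → a ≠ 5 + q → r.narr a = s.narr a) ∧
      (∀ j, j ≠ 2 → j ≠ 5 + q → r.nvar j = s.nvar j) ∧ r.nvar (5 + q) = 0 ∧
      (∀ k < i, r.narr (5 + q) k = 0) ∧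
      (∀ k < i, r.narr (3 + q) k = if k = s.nvar 7 then q + 1 else 0)) (s.setVar (5 + q) 0)
    ?_ ?_
  · rw [show (s.setVar (5 + q) 0).nvar 0 = s.nvar 0 by simp [e50]] at h
    exact h
  · simp +contextual [e52]
  · rintro i hi r hr hr0 ⟨h1, h2, h3, h4, h5, h6⟩
    have e7 := h3 7 (by omega) (by omega)
    have e35 := e53.symm
    simp only [run, Test.Holds, NExp.eval, State.nvar_setArr, hr, e7]
    split_ifs with hc
    · refine ⟨h1, fun a ha ha' => by simp [ha, ha', h2], fun j hj hj' => by simp [hj, h3 j hj hj'],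
        by simp [e52, h4], fun k hk => ?_, fun k hk => ?_⟩
      · simp only [State.narr_setVar, State.narr_setArr, if_neg e53, if_true,
          Function.update_apply]
        split_ifs with hki
        · rfl
        · exact h5 k (by omega)
      · simp only [State.narr_setVar, State.narr_setArr, if_neg e35, if_true,
          Function.update_apply]
        split_ifs with hki hk7 hk7
        · rfl
        · omega
        · omega
        · rw [h6 k (by omega), if_neg hk7]
    · refine ⟨h1, fun a ha ha' => by simp [ha, ha', h2], fun j hj hj' => by simp [hj, h3 j hj hj'],
        by simp [e52, h4], fun k hk => ?_, fun k hk => ?_⟩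
      · simp only [State.narr_setVar, State.narr_setArr, if_neg e53, if_true,
          Function.update_apply]
        split_ifs with hki
        · rfl
        · exact h5 k (by omega)
      · simp only [State.narr_setVar, State.narr_setArr, if_neg e35, if_true,
          Function.update_apply]
        split_ifs with hki hk7 hk7
        · omega
        · rfl
        · rw [h6 k (by omega), if_pos hk7]
        · rw [h6 k (by omega), if_neg hk7]

theorem restartCmd_spec :
    let s' := restartCmd.run s
    s'.rarr = s.rarr ∧ (∀ a < 3, s'.narr a = s.narr a) ∧ s'.nvar 0 = s.nvar 0 ∧
    ((s'.nvar 7 < s.nvar 0 ∧ s.narr 2 (s'.nvar 7) = 0) ∨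
      (s'.nvar 7 = s.nvar 0 ∧ ∀ k < s.nvar 0, s.narr 2 k ≠ 0)) ∧
    ∀ q < 2, s'.nvar (5 + q) = 0 ∧ (∀ k < s.nvar 0, s'.narr (5 + q) k = 0) ∧
      (∀ k < s.nvar 0, s'.narr (3 + q) k = if k = s'.nvar 7 then q + 1 else 0) := by
  intro s'
  obtain ⟨a1, a2, a3, a4⟩ := chooseCmd_spec s
  obtain ⟨b1, b2, b3, b4, b5, b6⟩ := resetCmd_spec (chooseCmd.run s) 0 (by omega)
  obtain ⟨c1, c2, c3, c4, c5, c6⟩ :=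
    resetCmd_spec ((resetCmd 0).run (chooseCmd.run s)) 1 (by omega)
  have hs' : s' = (resetCmd 1).run ((resetCmd 0).run (chooseCmd.run s)) := rfl
  rw [← hs'] at c1 c2 c3 c4 c5 c6
  generalize (resetCmd 0).run (chooseCmd.run s) = s₂ at *
  generalize chooseCmd.run s = s₁ at *
  have u0 : s'.nvar 0 = s.nvar 0 := by
    rw [c3 0 (by omega) (by omega), b3 0 (by omega) (by omega), a3 0 (by omega) (by omega)]
  have u07 : s₂.nvar 7 = s₁.nvar 7 := b3 7 (by omega) (by omega)
  have u7 : s'.nvar 7 = s₁.nvar 7 := by rw [c3 7 (by omega) (by omega), u07]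
  have v0 : s₁.nvar 0 = s.nvar 0 := a3 0 (by omega) (by omega)
  have w0 : s₂.nvar 0 = s.nvar 0 := by rw [b3 0 (by omega) (by omega), v0]
  refine ⟨by rw [c1, b1, a1], fun a ha => ?_, u0, ?_, fun q hq => ?_⟩
  · rw [c2 a (by omega) (by omega), b2 a (by omega) (by omega), a2]
  · rw [u7]
    exact a4
  · obtain rfl | rfl : q = 0 ∨ q = 1 := by omega
    · refine ⟨?_, fun k hk => ?_, fun k hk => ?_⟩
      · rw [c3 _ (by omega) (by omega), b4]
      · rw [c2 _ (by omega) (by omega), b5 k (by omega)]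
      · rw [c2 _ (by omega) (by omega), b6 k (by omega), u7]
    · refine ⟨c4, fun k hk => c5 k (by omega), fun k hk => ?_⟩
      rw [c6 k (by omega), u7, u07]

/-! ### The race in the memory -/

/-- The memory holds the state of a race after `r` rounds. -/
def HoldsRace (s : State) (r : ℕ) : Prop :=
  Race (s.nvar 0) (Rel s.rarr (s.narr 0) (s.narr 1)) (s.narr 2) (fun q => s.narr (3 + q))
    (fun q => s.narr (5 + q)) (fun q => s.nvar (5 + q)) (s.nvar 7) r

/-- The memory configurations agree on the instance, including the successors. -/
def SameInstance (s s' : State) : Prop :=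
  s'.nvar 0 = s.nvar 0 ∧ s'.rarr = s.rarr ∧ s'.narr 0 = s.narr 0 ∧ s'.narr 1 = s.narr 1

theorem SameInstance.trans {s s' s'' : State} (h : SameInstance s s') (h' : SameInstance s' s'') :
    SameInstance s s'' :=
  ⟨h'.1.trans h.1, h'.2.1.trans h.2.1, h'.2.2.1.trans h.2.2.1, h'.2.2.2.trans h.2.2.2⟩

theorem holdsRace_commit {s : State} {r q : ℕ} (hq : q < 2) (h : HoldsRace s r)
    (hc : s.nvar (5 + q) = 0)
    (hdone : ∀ k < s.nvar 0, s.narr (3 + q) k ≠ 0 → s.narr (5 + q) k ≠ 0) :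
    SameInstance s ((Cmd.seq (commitCmd q) restartCmd).run s) ∧
      HoldsRace ((Cmd.seq (commitCmd q) restartCmd).run s) (r + 1) := by
  obtain ⟨a1, a2, a3, a4⟩ := commitCmd_spec s q hq
  obtain ⟨b1, b2, b3, b4, b5⟩ := restartCmd_spec ((commitCmd q).run s)
  change SameInstance s (restartCmd.run ((commitCmd q).run s)) ∧
    HoldsRace (restartCmd.run ((commitCmd q).run s)) (r + 1)
  generalize (commitCmd q).run s = s₁ at *
  generalize restartCmd.run s₁ = s' at *
  have e0 : s₁.nvar 0 = s.nvar 0 := a3 0 (by omega)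
  have hsame : SameInstance s s' :=
    ⟨b3.trans e0, b1.trans a1, (b2 0 (by omega)).trans (a2 0 (by omega)),
      (b2 1 (by omega)).trans (a2 1 (by omega))⟩
  refine ⟨hsame, ?_⟩
  obtain ⟨c1, c2, c3, c4⟩ := hsame
  unfold HoldsRace
  rw [c1, c2, c3, c4, b2 2 (by omega)]
  rw [e0] at b4 b5
  exact Race.commit h hq hc hdone a4 b4 (fun q hq => (b5 q hq).2.2) (fun q hq => (b5 q hq).2.1)
    (fun q hq => (b5 q hq).1)

open Classical in
theorem stepCmd_spec (s : State) (q : ℕ) (hq : q < 2) :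
    let s' := (stepCmd q).run s
    let x := s.nvar (3 + q)
    let V := s.narr (3 + q)
    let R := Rel s.rarr (s.narr 0) (s.narr 1)
    s'.rarr = s.rarr ∧ (∀ a, a ≠ 3 + q → a ≠ 5 + q → s'.narr a = s.narr a) ∧
    (∀ j, j ≠ 2 → j ≠ 5 + q → s'.nvar j = s.nvar j) ∧
    (s.nvar (5 + q) ≠ 0 → s' = s) ∧
    (s.nvar (5 + q) = 0 → s'.narr (5 + q) = Function.update (s.narr (5 + q)) x 1 ∧
      (∀ k < s.nvar 0, s'.narr (3 + q) k =
        if R (V x) x k ∧ V k ≠ V x ∧ s.narr 2 k = 0 then 3 - V x else V k) ∧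
      (s'.nvar (5 + q) ≠ 0 ↔ ∃ k < s.nvar 0, R (V x) x k ∧ V k = V x)) := by
  intro s' x V R
  by_cases hc : s.nvar (5 + q) = 0
  · have hs' : s' = (propagateCmd q).run s := by
      simp [s', stepCmd, run, Test.Holds, NExp.eval, hc]
    rw [hs']
    obtain ⟨h1, h2, h3, h4, h5, h6⟩ := propagateCmd_spec s q hq hc
    exact ⟨h1, h2, h3, fun h => absurd hc h, fun _ => ⟨h4, h5, h6⟩⟩
  · have hs' : s' = s := by
      simp [s', stepCmd, run, Test.Holds, NExp.eval, hc]
    rw [hs']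
    exact ⟨rfl, fun _ _ _ => rfl, fun _ _ _ => rfl, fun _ => rfl, fun h => absurd h hc⟩

theorem holdsRace_step {s : State} {r : ℕ} (h : HoldsRace s r)
    (hx : ∀ q < 2, s.nvar (5 + q) = 0 → s.nvar (3 + q) < s.nvar 0 ∧
      s.narr (3 + q) (s.nvar (3 + q)) ≠ 0 ∧ s.narr (5 + q) (s.nvar (3 + q)) = 0) :
    SameInstance s ((Cmd.seq (stepCmd 0) (stepCmd 1)).run s) ∧
      HoldsRace ((Cmd.seq (stepCmd 0) (stepCmd 1)).run s) (r + 1) := by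
  obtain ⟨a1, a2, a3, a4, a5⟩ := stepCmd_spec s 0 (by omega)
  obtain ⟨b1, b2, b3, b4, b5⟩ := stepCmd_spec ((stepCmd 0).run s) 1 (by omega)
  change SameInstance s ((stepCmd 1).run ((stepCmd 0).run s)) ∧
    HoldsRace ((stepCmd 1).run ((stepCmd 0).run s)) (r + 1)
  generalize (stepCmd 0).run s = s₁ at *
  generalize (stepCmd 1).run s₁ = s' at *
  have n0 : s₁.nvar 0 = s.nvar 0 := a3 0 (by omega) (by omega)
  have n4 : s₁.nvar 4 = s.nvar 4 := a3 4 (by omega) (by omega)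
  have n6 : s₁.nvar 6 = s.nvar 6 := a3 6 (by omega) (by omega)
  have r0 : s₁.narr 0 = s.narr 0 := a2 0 (by omega) (by omega)
  have r1 : s₁.narr 1 = s.narr 1 := a2 1 (by omega) (by omega)
  have r2 : s₁.narr 2 = s.narr 2 := a2 2 (by omega) (by omega)
  have r4 : s₁.narr 4 = s.narr 4 := a2 4 (by omega) (by omega)
  have r6 : s₁.narr 6 = s.narr 6 := a2 6 (by omega) (by omega)
  have m3 : s'.narr 3 = s₁.narr 3 := b2 3 (by omega) (by omega)
  have m5 : s'.narr 5 = s₁.narr 5 := b2 5 (by omega) (by omega)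
  have m2 : s'.narr 2 = s.narr 2 := (b2 2 (by omega) (by omega)).trans r2
  have k5 : s'.nvar 5 = s₁.nvar 5 := b3 5 (by omega) (by omega)
  have k7 : s'.nvar 7 = s.nvar 7 :=
    (b3 7 (by omega) (by omega)).trans (a3 7 (by omega) (by omega))
  have hsame : SameInstance s s' :=
    ⟨(b3 0 (by omega) (by omega)).trans n0, b1.trans a1, (b2 0 (by omega) (by omega)).trans r0,
      (b2 1 (by omega) (by omega)).trans r1⟩
  refine ⟨hsame, ?_⟩
  obtain ⟨c1, c2, c3, c4⟩ := hsame
  simp only [Nat.reduceAdd, Nat.add_zero] at a4 a5 b4 b5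
  simp only [n0, n4, n6, r0, r1, r2, r4, r6, a1] at b4 b5
  unfold HoldsRace
  rw [c1, c2, c3, c4, m2, k7]
  refine Race.propagate Rel.symm h (x := fun q => s.nvar (3 + q)) ?_ hx ?_ ?_ ?_
  · intro q hq hc
    obtain rfl | rfl : q = 0 ∨ q = 1 := by omega
    · simp only [Nat.add_zero] at hc ⊢
      rw [m3, m5, k5, a4 hc]
      exact ⟨rfl, rfl, rfl⟩
    · simp only [Nat.reduceAdd] at hc ⊢
      rw [b4 hc, r4, r6, n6]
      exact ⟨rfl, rfl, rfl⟩
  · intro q hq hc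
    obtain rfl | rfl : q = 0 ∨ q = 1 := by omega
    · simp only [Nat.add_zero] at hc ⊢
      rw [m3]
      exact (a5 hc).2.1
    · simp only [Nat.reduceAdd] at hc ⊢
      have := (b5 hc).2.1
      rwa [a1, n4, r0, r1, r2, r4] at this
  · intro q hq hc
    obtain rfl | rfl : q = 0 ∨ q = 1 := by omega
    · simp only [Nat.add_zero] at hc ⊢
      rw [k5]
      exact (a5 hc).2.2
    · simp only [Nat.reduceAdd] at hc ⊢
      exact (b5 hc).2.2
  · intro q hq hc
    obtain rfl | rfl : q = 0 ∨ q = 1 := by omega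
    · simp only [Nat.add_zero] at hc ⊢
      rw [m5]
      exact (a5 hc).1
    · simp only [Nat.reduceAdd] at hc ⊢
      exact (b5 hc).1

theorem roundCmd_spec {s : State} {r : ℕ} (h : HoldsRace s r) :
    SameInstance s (roundCmd.run s) ∧ HoldsRace (roundCmd.run s) (r + 1) := by
  obtain ⟨a1, a2, a3, a4⟩ := findCmd_spec s 0 (by omega)
  obtain ⟨b1, b2, b3, b4⟩ := findCmd_spec ((findCmd 0).run s) 1 (by omega)
  have hrun : roundCmd.run s = (Cmd.cond (doneTest 0) (.seq (commitCmd 0) restartCmd)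
      (.cond (doneTest 1) (.seq (commitCmd 1) restartCmd)
        (.seq (stepCmd 0) (stepCmd 1)))).run ((findCmd 1).run ((findCmd 0).run s)) := rfl
  rw [hrun]
  generalize (findCmd 0).run s = s₁ at *
  generalize (findCmd 1).run s₁ = s₂ at *
  have n0 : s₁.nvar 0 = s.nvar 0 := a3 0 (by omega) (by omega)
  have v0 : s₂.nvar 0 = s.nvar 0 := (b3 0 (by omega) (by omega)).trans n0
  have vx0 : s₂.nvar 3 = s₁.nvar 3 := b3 3 (by omega) (by omega)
  have hr : s₂.rarr = s.rarr := b1.trans a1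
  have hn : s₂.narr = s.narr := b2.trans a2
  have hv : ∀ j, 5 ≤ j → s₂.nvar j = s.nvar j := fun j hj =>
    (b3 j (by omega) (by omega)).trans (a3 j (by omega) (by omega))
  have hsame : SameInstance s s₂ := ⟨v0, hr, by rw [hn], by rw [hn]⟩
  have h₂ : HoldsRace s₂ r := by
    unfold HoldsRace
    have e : (fun q => s₂.nvar (5 + q)) = fun q => s.nvar (5 + q) :=
      funext fun q => hv _ (by omega)
    rw [hr, hn, v0, e, hv 7 (by omega)]
    exact h
  have hfind : ∀ q < 2,
      (s₂.nvar (3 + q) = s₂.nvar 0 ∧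
        ∀ k < s₂.nvar 0, s₂.narr (3 + q) k ≠ 0 → s₂.narr (5 + q) k ≠ 0) ∨
      (s₂.nvar (3 + q) < s₂.nvar 0 ∧ s₂.narr (3 + q) (s₂.nvar (3 + q)) ≠ 0 ∧
        s₂.narr (5 + q) (s₂.nvar (3 + q)) = 0) := by
    intro q hq
    rw [hn, v0]
    obtain rfl | rfl : q = 0 ∨ q = 1 := by omega
    · simp only [Nat.add_zero] at a4 ⊢
      rw [vx0]
      exact a4
    · rw [a2, n0] at b4
      exact b4
  suffices hs : SameInstance s₂ _ ∧ HoldsRace _ (r + 1) from ⟨hsame.trans hs.1, hs.2⟩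
  -- if the test for completeness succeeds, then no literal was found
  have hdone : ∀ q < 2, (doneTest q).Holds s₂ → s₂.nvar (5 + q) = 0 ∧
      ∀ k < s₂.nvar 0, s₂.narr (3 + q) k ≠ 0 → s₂.narr (5 + q) k ≠ 0 := by
    rintro q hq ⟨h1, h2⟩
    simp only [Test.Holds, NExp.eval] at h1 h2
    rcases hfind q hq with h3 | h3
    · exact ⟨h1, h3.2⟩
    · omega
  have hpend : ∀ q < 2, ¬ (doneTest q).Holds s₂ → s₂.nvar (5 + q) = 0 →
      s₂.nvar (3 + q) < s₂.nvar 0 ∧ s₂.narr (3 + q) (s₂.nvar (3 + q)) ≠ 0 ∧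
        s₂.narr (5 + q) (s₂.nvar (3 + q)) = 0 := by
    intro q hq hd hc
    rcases hfind q hq with h3 | h3
    · exact absurd ⟨hc, h3.1⟩ hd
    · exact h3
  by_cases hd0 : (doneTest 0).Holds s₂
  · rw [show ∀ P Q, (Cmd.cond (doneTest 0) P Q).run s₂ = P.run s₂ from fun P Q => if_pos hd0]
    obtain ⟨h1, h2⟩ := hdone 0 (by omega) hd0
    exact holdsRace_commit (by omega) h₂ h1 h2
  rw [show ∀ P Q, (Cmd.cond (doneTest 0) P Q).run s₂ = Q.run s₂ from fun P Q => if_neg hd0]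
  by_cases hd1 : (doneTest 1).Holds s₂
  · rw [show ∀ P Q, (Cmd.cond (doneTest 1) P Q).run s₂ = P.run s₂ from fun P Q => if_pos hd1]
    obtain ⟨h1, h2⟩ := hdone 1 (by omega) hd1
    exact holdsRace_commit (by omega) h₂ h1 h2
  rw [show ∀ P Q, (Cmd.cond (doneTest 1) P Q).run s₂ = Q.run s₂ from fun P Q => if_neg hd1]
  refine holdsRace_step h₂ fun q hq hc => ?_
  obtain rfl | rfl : q = 0 ∨ q = 1 := by omega
  · exact hpend 0 hq hd0 hc
  · exact hpend 1 hq hd1 hc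

theorem HoldsRace.setVar_one {s : State} {r : ℕ} (h : HoldsRace s r) (v : ℕ) :
    HoldsRace (s.setVar 1 v) r := by
  have e : (fun q => (s.setVar 1 v).nvar (5 + q)) = fun q => s.nvar (5 + q) := by
    funext q
    have : 5 + q ≠ 1 := by omega
    simp [this]
  unfold HoldsRace
  rw [e]
  simpa [HoldsRace] using h

theorem SameInstance.setVar_one (s : State) (v : ℕ) : SameInstance s (s.setVar 1 v) :=
  ⟨by simp, rfl, rfl, rfl⟩

theorem roundCmd_wf : (sweep 1 roundCmd).WF := by
  simp [roundCmd, findCmd, doneTest, commitCmd, restartCmd, chooseCmd, resetCmd, stepCmd,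
    propagateCmd, consequenceCmd, WF, Writes]

theorem sweep_roundCmd_spec {s : State} {r : ℕ} (h : HoldsRace s r) :
    SameInstance s ((sweep 1 roundCmd).run s) ∧
      HoldsRace ((sweep 1 roundCmd).run s) (r + s.nvar 0) := by
  refine run_sweep_induction roundCmd_wf (fun i s' => SameInstance s s' ∧ HoldsRace s' (r + i)) s
    ⟨SameInstance.setVar_one s 0, h.setVar_one 0⟩ ?_
  rintro i - s₁ - - ⟨h1, h2⟩
  obtain ⟨h3, h4⟩ := roundCmd_spec h2
  exact ⟨(h1.trans h3).trans (SameInstance.setVar_one _ _), h4.setVar_one _⟩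

/-! ### The cyclic successors -/

/-- Among the first `j` points, `b` is the best candidate for the cyclic successor of `i` in its
class: the first one after `i`, or else the first one at all, or else `i` itself. -/
def IsCandidate (col : ℕ → ℕ) (i j b : ℕ) : Prop :=
  col b = col i ∧
  ((b = i ∧ ∀ k < j, col k = col i → k = i) ∨
    (b < i ∧ b < j ∧ ∀ k < j, col k = col i → k ≤ i ∧ b ≤ k) ∨
    (i < b ∧ b < j ∧ ∀ k < j, col k = col i → i < k → b ≤ k))

theorem IsCandidate.update {col : ℕ → ℕ} {i j b : ℕ} (h : IsCandidate col i j b)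
    (hj : col j = col i ∧ j ≠ i ∧ (b = i ∨ b < i ∧ i < j)) : IsCandidate col i (j + 1) j := by
  obtain ⟨h0, h⟩ := h
  refine ⟨hj.1, ?_⟩
  rcases lt_or_gt_of_ne hj.2.1 with hlt | hgt
  · refine .inr (.inl ⟨hlt, by omega, fun k hk hc => ?_⟩)
    rcases Nat.lt_succ_iff_lt_or_eq.1 hk with hk | rfl
    · rcases h with ⟨-, h⟩ | ⟨h1, -, h⟩ | ⟨h1, -, h⟩
      · have := h k hk hc
        omega
      · omega
      · omega
    · omega
  · refine .inr (.inr ⟨hgt, by omega, fun k hk hc hik => ?_⟩)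
    rcases Nat.lt_succ_iff_lt_or_eq.1 hk with hk | rfl
    · rcases h with ⟨-, h⟩ | ⟨h1, -, h⟩ | ⟨h1, -, h⟩
      · have := h k hk hc
        omega
      · have := h k hk hc
        omega
      · omega
    · omega

theorem IsCandidate.keep {col : ℕ → ℕ} {i j b : ℕ} (h : IsCandidate col i j b)
    (hj : ¬ (col j = col i ∧ j ≠ i ∧ (b = i ∨ b < i ∧ i < j))) : IsCandidate col i (j + 1) b := by
  obtain ⟨h0, h⟩ := h
  refine ⟨h0, ?_⟩
  rcases h with ⟨hb, h⟩ | ⟨hb, hbj, h⟩ | ⟨hb, hbj, h⟩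
  · refine .inl ⟨hb, fun k hk hc => ?_⟩
    rcases Nat.lt_succ_iff_lt_or_eq.1 hk with hk | rfl
    · exact h k hk hc
    · tauto
  · refine .inr (.inl ⟨hb, by omega, fun k hk hc => ?_⟩)
    rcases Nat.lt_succ_iff_lt_or_eq.1 hk with hk | rfl
    · exact h k hk hc
    · have : ¬ i < k := fun hik => hj ⟨hc, by omega, .inr ⟨hb, hik⟩⟩
      omega
  · refine .inr (.inr ⟨hb, by omega, fun k hk hc hik => ?_⟩)
    rcases Nat.lt_succ_iff_lt_or_eq.1 hk with hk | rfl
    · exact h k hk hc hik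
    · omega

theorem succCmd_spec (s : State) :
    let s' := succCmd.run s
    s'.rarr = s.rarr ∧ (∀ a, a ≠ 1 → s'.narr a = s.narr a) ∧
    (∀ j, j ≠ 1 → j ≠ 2 → s'.nvar j = s.nvar j) ∧
    ∀ i < s.nvar 0, IsCandidate (s.narr 0) i (s.nvar 0) (s'.narr 1 i) := by
  refine run_sweep_induction (k := 1) (by simp [WF, Writes])
    (fun i s' => s'.rarr = s.rarr ∧ (∀ a, a ≠ 1 → s'.narr a = s.narr a) ∧
      (∀ j, j ≠ 1 → j ≠ 2 → s'.nvar j = s.nvar j) ∧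
      ∀ m < i, IsCandidate (s.narr 0) m (s.nvar 0) (s'.narr 1 m)) s ?_ ?_
  · exact ⟨rfl, fun _ _ => rfl, fun j hj _ => by simp [hj], fun m hm => absurd hm (by omega)⟩
  · rintro i hi r hr hr0 ⟨h1, h2, h3, h4⟩
    simp only [run.eq_3]
    have hr₁ : (nput 1 (.var 1) (.var 1)).run r =
        r.setArr 1 (Function.update (r.narr 1) i i) := by
      simp [run, NExp.eval, hr]
    rw [hr₁]
    have h := run_sweep_induction (k := 2)
      (P := .cond
        (.conj (.neq (.get 0 (.var 2)) (.get 0 (.var 1)))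
        (.conj (.neg (.neq (.var 2) (.var 1)))
          (.disj (.neq (.get 1 (.var 1)) (.var 1))
            (.conj (.nlt (.get 1 (.var 1)) (.var 1)) (.nlt (.var 1) (.var 2))))))
        (.nput 1 (.var 1) (.var 2)) .skip) (by simp [WF, Writes])
      (fun j s' => s'.rarr = s.rarr ∧ (∀ a, a ≠ 1 → s'.narr a = s.narr a) ∧
        (∀ j, j ≠ 1 → j ≠ 2 → s'.nvar j = s.nvar j) ∧ s'.nvar 1 = i ∧
        (∀ m < i, IsCandidate (s.narr 0) m (s.nvar 0) (s'.narr 1 m)) ∧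
        IsCandidate (s.narr 0) i j (s'.narr 1 i)) (r.setArr 1 (Function.update (r.narr 1) i i))
      ?_ ?_
    · rw [show (r.setArr 1 (Function.update (r.narr 1) i i)).nvar 0 = s.nvar 0 from hr0] at h
      obtain ⟨k1, k2, k3, -, k4, k5⟩ := h
      refine ⟨k1, k2, fun j hj hj' => by simp [hj, k3 j hj hj'], fun m hm => ?_⟩
      rcases Nat.lt_succ_iff_lt_or_eq.1 hm with hm | rfl
      · exact k4 m hm
      · exact k5
    · refine ⟨h1, fun a ha => by simp [ha, h2], fun j hj hj' => by simp [hj', h3 j hj hj'],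
        by simp [hr], fun m hm => ?_, ?_⟩
      · have : m ≠ i := by omega
        simpa [this] using h4 m hm
      · simp [IsCandidate]
    · rintro j hj r' hr' hr0' ⟨k1, k2, k3, k4, k5, k6⟩
      simp only [run, Test.Holds, NExp.eval, hr', k4, k2 0 (by omega)]
      split_ifs with hc
      · refine ⟨k1, fun a ha => by simp [ha, k2], fun j hj hj' => by simp [hj', k3 j hj hj'],
          by simp [k4], fun m hm => ?_, ?_⟩
        · have : m ≠ i := by omega
          simpa [this] using k5 m hm
        · simpa using k6.update hc
      · exact ⟨k1, k2, fun j hj hj' => by simp [hj', k3 j hj hj'], by simp [k4], k5, k6.keep hc⟩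

/-! ### The decision procedure -/

section

variable {n : ℕ} {color : Fin n → ℕ} {col nx : ℕ → ℕ}

theorem isClassCycle_of_isCandidate (hcol : ∀ i : Fin n, col i = color i)
    (hnx : ∀ i < n, IsCandidate col i n (nx i)) (hlt : ∀ i : Fin n, nx i < n) :
    IsClassCycle color (fun i => ⟨nx i, hlt i⟩) := by
  refine ⟨fun i => ?_, fun i j hc hij h => ?_, fun i j h => ?_⟩
  · rw [← hcol, ← hcol]
    exact (hnx i i.2).1
  · have h' : nx i = i := congrArg Fin.val h
    obtain ⟨-, ⟨-, h1⟩ | h1 | h1⟩ := hnx i i.2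
    · exact hij (Fin.ext (h1 j j.2 (by rw [hcol, hcol, hc])).symm)
    · omega
    · omega
  · have h' : nx i = nx j := congrArg Fin.val h
    obtain ⟨ci, hi⟩ := hnx i i.2
    obtain ⟨cj, hj⟩ := hnx j j.2
    rw [h'] at ci hi
    have hc : col i = col j := ci.symm.trans cj
    apply Fin.ext
    rcases hi with ⟨hi1, hi⟩ | ⟨hi1, -, hi⟩ | ⟨hi1, -, hi⟩
    · exact (hi j j.2 hc.symm).symm
    · rcases hj with ⟨hj1, hj⟩ | ⟨hj1, -, hj⟩ | ⟨hj1, -, hj⟩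
      · exact hj i i.2 hc
      · have := hi j j.2 hc.symm
        have := hj i i.2 hc
        omega
      · have := hi j j.2 hc.symm
        omega
    · rcases hj with ⟨hj1, hj⟩ | ⟨hj1, -, hj⟩ | ⟨hj1, -, hj⟩
      · exact hj i i.2 hc
      · have := hj i i.2 hc
        omega
      · have := hi j j.2 hc.symm
        have := hj i i.2 hc
        omega

open Classical in
theorem exists_solves_iff {p : Fin n → ℝ × ℝ} {X : ℕ → ℕ → ℝ}
    (hcol : ∀ i : Fin n, col i = color i) (hX : ∀ i : Fin n, (X 0 i, X 1 i) = p i)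
    (hlt : ∀ i : Fin n, nx i < n) :
    (∃ σ, Solves n (Rel X col nx) σ) ↔ ∃ σ : Fin n → Prop,
      (∀ i j, i ≠ j → color i = color j → σ i ∨ σ j) ∧
      ∀ i j, Crosses (p i) (p ⟨nx i, hlt i⟩) (p j) (p ⟨nx j, hlt j⟩) → ¬ (σ i ∧ σ j) := by
  have hcr : ∀ i j : Fin n, Crosses (X 0 i, X 1 i) (X 0 (nx i), X 1 (nx i)) (X 0 j, X 1 j)
      (X 0 (nx j), X 1 (nx j)) ↔ Crosses (p i) (p ⟨nx i, hlt i⟩) (p j) (p ⟨nx j, hlt j⟩) := by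
    intro i j
    rw [← hX i, ← hX j, ← hX ⟨nx i, hlt i⟩, ← hX ⟨nx j, hlt j⟩]
  constructor
  · rintro ⟨σ, h1, h2⟩
    refine ⟨fun i => σ i = 1, fun i j hij hc => ?_, ?_⟩
    · by_contra hcon
      push Not at hcon
      have ei := (h1 i i.2).resolve_left hcon.1
      have ej := (h1 j j.2).resolve_left hcon.2
      refine h2 i i.2 j j.2 (.inr ⟨ei, fun h => hij (Fin.ext h), ?_⟩) (ej.trans ei.symm)
      rw [hcol, hcol, hc]
    · rintro i j hcross ⟨hi, hj⟩
      exact h2 i i.2 j j.2 (.inl ⟨hi, (hcr i j).2 hcross⟩) (hj.trans hi.symm)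
  · rintro ⟨σ, h1, h2⟩
    let τ : ℕ → ℕ := fun i => if h : i < n then (if σ ⟨i, h⟩ then 1 else 2) else 0
    have hτ : ∀ i : Fin n, τ i = if σ i then 1 else 2 := fun i => by simp [τ]
    refine ⟨τ, fun i hi => ?_, fun i hi k hk hR he => ?_⟩
    · rw [hτ ⟨i, hi⟩]
      split_ifs <;> simp
    · lift i to Fin n using hi
      lift k to Fin n using hk
      rw [hτ k, hτ i] at he
      rw [hτ i] at hR
      rcases hR with ⟨hv, hR⟩ | ⟨hv, hne, hR⟩
      · have hi : σ i := by
          by_contra h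
          simp [h] at hv
        have hk : σ k := by
          by_contra h
          simp [h, hi] at he
        exact h2 i k ((hcr i k).1 hR) ⟨hi, hk⟩
      · have hi : ¬ σ i := by
          intro h
          simp [h] at hv
        have hk : ¬ σ k := by
          intro h
          simp [h, hi] at he
        rw [hcol, hcol] at hR
        rcases h1 i k (fun h => hne (by rw [h])) hR with h | h
        · exact hi h
        · exact hk h

end

theorem mainCmd_wf : mainCmd.WF ∧ ¬ mainCmd.Writes 0 := by
  simp [mainCmd, succCmd, roundCmd, findCmd, doneTest, commitCmd, restartCmd, chooseCmd, resetCmd,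
    stepCmd, propagateCmd, consequenceCmd, WF, Writes]

theorem mainCmd_depth : mainCmd.depth = 2 := rfl

theorem mainCmd_spec {n : ℕ} {p : Fin n → ℝ × ℝ} {color : Fin n → ℕ} (hp : GeneralPosition p)
    (hcard : ∀ a : ℕ, (Finset.univ.filter (fun i : Fin n => color i = a)).card ≤ 3) :
    let s := mainCmd.run (input p color)
    (s.nvar 5 ≠ 0 ∧ s.nvar 6 ≠ 0) ↔ ¬ HasPartitionForest p color := by
  intro s
  have i0 : (input p color).nvar 0 = n := by simp [input]
  have iA : (input p color).narr 2 = fun _ => 0 := by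
    funext i
    simp [input]
  have icol : ∀ i : Fin n, (input p color).narr 0 i = color i := by
    intro i
    simp [input]
  have iX : ∀ i : Fin n, ((input p color).rarr 0 i, (input p color).rarr 1 i) = p i := by
    intro i
    simp [input]
  obtain ⟨a1, a2, a3, a4⟩ := succCmd_spec (input p color)
  obtain ⟨b1, b2, b3, b4, b5⟩ := restartCmd_spec (succCmd.run (input p color))
  have hs : s = roundCmd.run ((sweep 1 roundCmd).run ((sweep 1 roundCmd).run
    (restartCmd.run (succCmd.run (input p color))))) := rfl
  rw [hs]
  generalize input p color = s₀ at *
  generalize succCmd.run s₀ = s₁ at *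
  generalize restartCmd.run s₁ = s₂ at *
  have n1 : s₁.nvar 0 = n := (a3 0 (by omega) (by omega)).trans i0
  have n2 : s₂.nvar 0 = n := b3.trans n1
  rw [n1] at b4 b5
  rw [i0] at a4
  have A1 : s₁.narr 2 = fun _ => 0 := (a2 2 (by omega)).trans iA
  have h₂ : HoldsRace s₂ 0 := by
    unfold HoldsRace
    rw [n2, b2 2 (by omega)]
    exact Race.init (fun i _ => by rw [A1]) b4 (fun q hq => (b5 q hq).2.2)
      (fun q hq => (b5 q hq).2.1) (fun q hq => (b5 q hq).1)
  obtain ⟨e3, h₃⟩ := sweep_roundCmd_spec h₂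
  obtain ⟨e4, h₄⟩ := sweep_roundCmd_spec h₃
  obtain ⟨e5, h₅⟩ := roundCmd_spec h₄
  have e35 := (e3.trans e4).trans e5
  rw [e3.1, n2] at h₅
  generalize roundCmd.run _ = s' at *
  obtain ⟨f1, f2, f3, f4⟩ := e35
  unfold HoldsRace at h₅
  have hout := h₅.outcome (by rw [f1, n2]; omega)
  refine Iff.trans hout (not_congr ?_)
  have hX : s'.rarr = s₀.rarr := (f2.trans b1).trans a1
  have hcol : s'.narr 0 = s₀.narr 0 := (f3.trans (b2 0 (by omega))).trans (a2 0 (by omega))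
  have hnx : s'.narr 1 = s₁.narr 1 := f4.trans (b2 1 (by omega))
  rw [hX, hcol, hnx, f1.trans n2]
  have hlt : ∀ i : Fin n, s₁.narr 1 i < n := by
    intro i
    have := i.2
    obtain ⟨-, h | h | h⟩ := a4 i i.2 <;> omega
  rw [hasPartitionForest_iff hp (isClassCycle_of_isCandidate icol a4 hlt) hcard]
  exact exists_solves_iff icol iX hlt

end PartitionForest

theorem theorem1 :
    ∃ (P : RealRAM.Prog) (T : ℕ → ℕ),
      (fun n : ℕ => (T n : ℝ)) =O[atTop] (fun n : ℕ => (n : ℝ) ^ 2) ∧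
      ∀ (n : ℕ) (p : Fin n → ℝ × ℝ) (color : Fin n → ℕ),
        PartitionForest.GeneralPosition p →
        (∀ a : ℕ, (Finset.univ.filter (fun i : Fin n => color i = a)).card ≤ 3) →
        ∃ (s : RealRAM.State) (t : ℕ),
          RealRAM.Exec P (PartitionForest.input p color) s t ∧ t ≤ T n ∧
          (PartitionForest.HasPartitionForest p color → s.nvar 0 = 1) ∧
          (¬ PartitionForest.HasPartitionForest p color → s.nvar 0 = 0) := by
  refine ⟨.seq PartitionForest.mainCmd.toProg
    (.cond (.conj (.neg (.neq (.var 5) (.const 0))) (.neg (.neq (.var 6) (.const 0))))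
      (.nset 0 (.const 0)) (.nset 0 (.const 1))),
    fun n => PartitionForest.mainCmd.coeff * (n + 1) ^ 2 + 12, ?_, ?_⟩
  · generalize PartitionForest.mainCmd.coeff = K
    refine IsBigO.of_bound (4 * K + 12) ?_
    filter_upwards [eventually_ge_atTop 1] with n hn
    have hn' : (1 : ℝ) ≤ n := by exact_mod_cast hn
    rw [Real.norm_of_nonneg (by positivity), Real.norm_of_nonneg (by positivity)]
    push_cast
    have h1 : ((n : ℝ) + 1) ^ 2 ≤ 4 * (n : ℝ) ^ 2 := by nlinarith
    have h2 : (1 : ℝ) ≤ (n : ℝ) ^ 2 := by nlinarith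
    have h3 : (0 : ℝ) ≤ K := by positivity
    nlinarith [mul_le_mul_of_nonneg_left h1 h3]
  · intro n p color hp hcard
    obtain ⟨t, ht, hle⟩ := RealRAM.Cmd.exec_toProg PartitionForest.mainCmd
      PartitionForest.mainCmd_wf.1 PartitionForest.mainCmd_wf.2 (PartitionForest.input p color)
    have hspec := PartitionForest.mainCmd_spec hp hcard
    rw [PartitionForest.mainCmd_depth,
      show (PartitionForest.input p color).nvar 0 = n by simp [PartitionForest.input]] at hle
    generalize PartitionForest.mainCmd.run (PartitionForest.input p color) = s at *
    by_cases hyes : PartitionForest.HasPartitionForest p color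
    · have hc : ¬ (s.nvar 5 ≠ 0 ∧ s.nvar 6 ≠ 0) := fun h => hspec.1 h hyes
      refine ⟨_, _, .seq ht (.cond_false ?_ (.nset 0 (.const 1) s)), ?_, fun _ => ?_,
        fun h => absurd hyes h⟩
      · simpa [RealRAM.Test.Holds, RealRAM.NExp.eval] using hc
      · simp only [RealRAM.Test.cost, RealRAM.NExp.cost]
        omega
      · simp [RealRAM.NExp.eval]
    · have hc := hspec.2 hyes
      refine ⟨_, _, .seq ht (.cond_true ?_ (.nset 0 (.const 0) s)), ?_, fun h => absurd h hyes,
        fun _ => ?_⟩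
      · simpa [RealRAM.Test.Holds, RealRAM.NExp.eval] using hc
      · simp only [RealRAM.Test.cost, RealRAM.NExp.cost]
        omega
      · simp [RealRAM.NExp.eval]
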